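/- Let $\Bbbk$ be a field; algebras are associative, not necessarily unital, and $\otimes=\otimes_\Bbbk$. For a nondegenerate algebra $B$ let $M(B)$ be its multiplier algebra, i.e. the algebra of pairs $(L,R)$ of linear maps on $B$ with $a\,L(b)=R(a)\,b$; we regard $B\subseteq M(B)$. A multiplier Hopf algebra (Van Daele) is a nondegenerate algebra $A$ with a coassociative homomorphism $\Delta_A:A\to M(A\otimes A)$ such that $a\otimes b\mapsto\Delta_A(a)(1\otimes b)$ and $a\otimes b\mapsto(a\otimes1)\Delta_A(b)$ are bijections of $A\otimes A$; it is regular if $A$ with the opposite comultiplication is also a multiplier Hopf algebra. Its counit is denoted $\varepsilon_A$, identity maps are denoted $\imath$, and $\tau$ denotes flips of tensor factors. Nondegenerate homomorphisms are extended to multiplier algebras. Let $A$ and $Y$ be regular multiplier Hopf algebras over $\Bbbk$ and let $\rho:Y\to M(A\otimes Y)$ be linear. Write $$T(y\otimes a)=\rho(y)(a\otimes1),\qquad \overline T(a\otimes y)=(a\otimes1)\rho(y).$$ **Comodule coalgebra.** $Y$ is an $A$-comodule coalgebra via $\rho$ if $\rho$ is injective and, for all $y,y'\in Y$, $a\in A$: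 (1) $\rho(y)(a\otimes1)\in A\otimes Y$ and $(a\otimes1)\rho(y)\in A\otimes Y$; (2) $(\imath\otimes\rho)\rho(y)=(\Delta_A\otimes\imath)\rho(y)$, where $(\imath\otimes\rho)\rho(y)$ is the multiplier determined by $(\imath\otimes\rho)(\rho(y))(a\otimes b\otimes1)=(\imath\otimes\rho)(\rho(y)(a\otimes1))(1\otimes b\otimes1)$ and $(a\otimes b\otimes1)(\imath\otimes\rho)(\rho(y))=(1\otimes b\otimes1)(\imath\otimes\rho)((a\otimes1)\rho(y))$; (3) $\big((\imath\otimes T)(\Delta_Y(y)\otimes a)\big)(1\otimes1\otimes y')$ and $(1\otimes1\otimes y')\big((\imath\otimes T)(\Delta_Y(y)\otimes a)\big)$ lie in $Y\otimes A\otimes Y$, where $(\imath\otimes T)(\Delta_Y(y)\otimes a)$ is the multiplier given on $p\in Y$ (acting on the first factor) by $(\imath\otimes T)(\Delta_Y(y)(p\otimes1)\otimes a)$ and $(\imath\otimes T)((p\otimes1)\Delta_Y(y)\otimes a)$; (4) $(\imath\otimes\Delta_Y)T(y\otimes a)=(T\otimes\imath)(\imath\otimes T)(\Delta_Y(y)\otimes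 a)$, an equality of multipliers for the actions of $Y$ on the third factor, the right-hand side being covered by means of (3). **Symmetric partial comodule coalgebra.** $Y$ is a symmetric partial $A$-comodule coalgebra via $\rho$ if (1), (3), (4) hold and, for all $y,y'\in Y$, $a\in A$: (5) $(\varepsilon_A\otimes\imath)\rho(y)=y$; (6) $(\imath\otimes T)(T\otimes\imath)(\imath\otimes\Delta_A)(y\otimes a)=((\imath\otimes\varepsilon_Y)T\otimes\imath\otimes\imath)(\imath\otimes(\Delta_A\otimes\imath)T)(\Delta_Y\otimes\imath)(y\otimes a)$, meaning that both sides agree after multiplication on the right by $1\otimes a'\otimes y'$ for all $a'\in A$, $y'\in Y$ (the right-hand side being covered by means of (3)); (7) $\big((\overline T\otimes\imath)(a\otimes\Delta_Y(y))\big)(1\otimes y'\otimes1)\in A\otimes Y\otimes Y$, where $(\overline T\otimes\imath)(a\otimes\Delta_Y(y))$ is the multiplier given on $q\in Y$ (acting on the third factor) by $(\overline T\otimes\imath)(a\otimes\Delta_Y(y)(1\otimes q))$ and $(\overline T\otimes\imath)(a\otimes(1\otimes q)\Delta_Y(y))$; (8) $(\imath\otimes\overline T)(\imath\otimes\tau_{Y,A})(\overline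 T\otimes\imath)(\imath\otimes\tau_{A,Y})(\Delta_A\otimes\imath)(a\otimes y)=((\imath\otimes\varepsilon_Y)\overline T\otimes\imath\otimes\imath)(\imath\otimes\tau_{A\otimes Y,Y})((\Delta_A\otimes\imath)\overline T\otimes\imath)(\imath\otimes\Delta_Y)(a\otimes y)$, meaning that both sides agree after multiplication on the left by $1\otimes b\otimes1$ and on the right by $1\otimes1\otimes y'$ for all $b\in A$, $y'\in Y$ (the right-hand side being covered by means of (7)). **Proposition.** If $Y$ is an $A$-comodule coalgebra via $\rho$, then $Y$ is a symmetric partial $A$-comodule coalgebra via the same $\rho$. -/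

import Mathlib

open scoped TensorProduct

namespace MultHopf

noncomputable section

/-! Multiplier algebras of (not necessarily unital) algebras over a field. -/

section Multipliers

variable (k : Type*) [Field k]
variable (B : Type*) [NonUnitalRing B] [Module k B] [IsScalarTower k B B] [SMulCommClass k B B]

/-- The product of `B` is nondegenerate. -/
def IsNondegenerate (B : Type*) [NonUnitalRing B] : Prop :=
  (∀ a : B, (∀ b : B, a * b = 0) → a = 0) ∧ (∀ b : B, (∀ a : B, a * b = 0) → b = 0)

/-- The algebra of pairs `(L, R)` of linear maps on `B` with `a * L b = R a * b`.
The product is `(L, R) (L', R') = (L ∘ L', R' ∘ R)` (hence the opposite algebra in the second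
component) and the unit is `(id, id)`. -/
def multiplierSubalgebra : Subalgebra k (Module.End k B × (Module.End k B)ᵐᵒᵖ) where
  carrier := {m | ∀ a b : B, a * m.1 b = m.2.unop a * b}
  mul_mem' := by
    intro m n hm hn a b
    have h1 := hm a (n.1 b)
    have h2 := hn (m.2.unop a) b
    simpa using h1.trans h2
  add_mem' := by
    intro m n hm hn a b
    have h1 := hm a b
    have h2 := hn a b
    simp [mul_add, add_mul, h1, h2]
  algebraMap_mem' := by
    intro r a b
    simp [Module.algebraMap_end_apply, mul_smul_comm, smul_mul_assoc]

/-- The multiplier algebra `M(B)`. -/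
abbrev Multiplier : Type _ := ↥(multiplierSubalgebra k B)

variable {k B}

/-- `lmul m b` is the element `m b` of `B`. -/
def lmul (m : Multiplier k B) : B →ₗ[k] B := m.1.1

/-- `rmul m b` is the element `b m` of `B`. -/
def rmul (m : Multiplier k B) : B →ₗ[k] B := m.1.2.unop

theorem mul_lmul (m : Multiplier k B) (a b : B) : a * lmul m b = rmul m a * b := m.2 a b

/-- The multiplier with given left and right multiplication operators. -/
def mkMultiplier (L R : B →ₗ[k] B) (h : ∀ a b, a * L b = R a * b) : Multiplier k B :=
  ⟨(L, MulOpposite.op R), h⟩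

theorem multiplier_ext {m n : Multiplier k B} (hl : ∀ b, lmul m b = lmul n b)
    (hr : ∀ b, rmul m b = rmul n b) : m = n := by
  apply Subtype.ext
  apply Prod.ext
  · exact LinearMap.ext hl
  · exact MulOpposite.unop_injective (LinearMap.ext hr)

variable (k B)

/-- The canonical map `B → M(B)`. -/
def incl : B →ₗ[k] Multiplier k B where
  toFun b := mkMultiplier (LinearMap.mulLeft k b) (LinearMap.mulRight k b)
    (fun a c => by simp [mul_assoc])
  map_add' a b := by
    apply multiplier_ext <;> intro c
    · exact add_mul a b c
    · exact mul_add c a b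
  map_smul' r a := by
    apply multiplier_ext <;> intro c
    · exact smul_mul_assoc r a c
    · exact mul_smul_comm r c a

variable {k B}

section Tensor

variable {C : Type*} [NonUnitalRing C] [Module k C] [IsScalarTower k C C] [SMulCommClass k C C]

/-- `tens m n` is the multiplier `m ⊗ n` of `B ⊗ C`. -/
def tens : Multiplier k B →ₗ[k] Multiplier k C →ₗ[k] Multiplier k (B ⊗[k] C) :=
  LinearMap.mk₂ k
    (fun m n => mkMultiplier (TensorProduct.map (lmul m) (lmul n))
      (TensorProduct.map (rmul m) (rmul n)) (by
        intro x y
        induction x using TensorProduct.induction_on with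
        | zero => simp
        | add x₁ x₂ h₁ h₂ => simp only [add_mul, map_add, h₁, h₂]
        | tmul b c =>
          induction y using TensorProduct.induction_on with
          | zero => simp
          | add y₁ y₂ h₁ h₂ => simp only [mul_add, map_add, h₁, h₂]
          | tmul b' c' =>
            simp [Algebra.TensorProduct.tmul_mul_tmul, mul_lmul]))
    (by
      intro m₁ m₂ n
      apply multiplier_ext <;> intro x
      · exact LinearMap.congr_fun (TensorProduct.map_add_left (lmul m₁) (lmul m₂) (lmul n)) x
      · exact LinearMap.congr_fun (TensorProduct.map_add_left (rmul m₁) (rmul m₂) (rmul n)) x)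
    (by
      intro r m n
      apply multiplier_ext <;> intro x
      · exact LinearMap.congr_fun (TensorProduct.map_smul_left r (lmul m) (lmul n)) x
      · exact LinearMap.congr_fun (TensorProduct.map_smul_left r (rmul m) (rmul n)) x)
    (by
      intro m n₁ n₂
      apply multiplier_ext <;> intro x
      · exact LinearMap.congr_fun (TensorProduct.map_add_right (lmul m) (lmul n₁) (lmul n₂)) x
      · exact LinearMap.congr_fun (TensorProduct.map_add_right (rmul m) (rmul n₁) (rmul n₂)) x)
    (by
      intro r m n
      apply multiplier_ext <;> intro x
      · exact LinearMap.congr_fun (TensorProduct.map_smul_right r (lmul m) (lmul n)) x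
      · exact LinearMap.congr_fun (TensorProduct.map_smul_right r (rmul m) (rmul n)) x)

end Tensor

/-- A linear map into `M(B)` all of whose values lie in `B`, read as a linear map into `B`
(with the value `0` if some value does not lie in `B`). It is unique when `B` is nondegenerate. -/
def descend {X : Type*} [AddCommGroup X] [Module k X] (φ : X →ₗ[k] Multiplier k B) :
    X →ₗ[k] B := by
  classical
  exact if h : ∃ ψ : X →ₗ[k] B, incl k B ∘ₗ ψ = φ then h.choose else 0

theorem incl_descend {X : Type*} [AddCommGroup X] [Module k X] (φ : X →ₗ[k] Multiplier k B)
    (h : ∀ x, φ x ∈ LinearMap.range (incl k B)) (x : X) : incl k B (descend φ x) = φ x := by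
  have hex : ∃ ψ : X →ₗ[k] B, incl k B ∘ₗ ψ = φ := by
    obtain ⟨ψ, hψ⟩ := Module.projective_lifting_property (incl k B).rangeRestrict
      (φ.codRestrict (LinearMap.range (incl k B)) h) (incl k B).surjective_rangeRestrict
    refine ⟨ψ, LinearMap.ext fun y => ?_⟩
    exact congrArg Subtype.val (LinearMap.congr_fun hψ y)
  have : descend φ = hex.choose := by
    simp only [descend]
    exact dif_pos hex
  rw [this]
  exact LinearMap.congr_fun hex.choose_spec x

/-- The value at `m ∈ M(B)` of the extension to `M(B)` of a nondegenerate homomorphism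
`φ : B → M(C)`: the multiplier `n` of `C` with `n φ(b) = φ(m b)` and `φ(b) n = φ(b m)` for all
`b ∈ B`. -/
def extend {C : Type*} [NonUnitalRing C] [Module k C] [IsScalarTower k C C] [SMulCommClass k C C]
    (φ : B →ₗ[k] Multiplier k C) (m : Multiplier k B) : Multiplier k C := by
  classical
  exact if h : ∃ n : Multiplier k C,
      ∀ b : B, n * φ b = φ (lmul m b) ∧ φ b * n = φ (rmul m b) then h.choose else 0

end Multipliers

/-! Multiplier Hopf algebras. -/

section Hopf

variable {k : Type*} [Field k]
variable {A : Type*} [NonUnitalRing A] [Module k A] [IsScalarTower k A A] [SMulCommClass k A A]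

/-- `a ⊗ b ↦ Δ(a)(1 ⊗ b)`. -/
def comulR2 (Δ : A →ₗ[k] Multiplier k (A ⊗[k] A)) : A ⊗[k] A →ₗ[k] A ⊗[k] A :=
  descend (TensorProduct.lift
    ((LinearMap.mul k (Multiplier k (A ⊗[k] A))).compl₁₂ Δ (tens 1 ∘ₗ incl k A)))

/-- `a ⊗ b ↦ (a ⊗ 1)Δ(b)`. -/
def comulL1 (Δ : A →ₗ[k] Multiplier k (A ⊗[k] A)) : A ⊗[k] A →ₗ[k] A ⊗[k] A :=
  descend (TensorProduct.lift
    ((LinearMap.mul k (Multiplier k (A ⊗[k] A))).compl₁₂ (tens.flip 1 ∘ₗ incl k A) Δ))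

/-- `a ⊗ b ↦ Δ(a)(b ⊗ 1)`. -/
def comulR1 (Δ : A →ₗ[k] Multiplier k (A ⊗[k] A)) : A ⊗[k] A →ₗ[k] A ⊗[k] A :=
  descend (TensorProduct.lift
    ((LinearMap.mul k (Multiplier k (A ⊗[k] A))).compl₁₂ Δ (tens.flip 1 ∘ₗ incl k A)))

/-- `a ⊗ b ↦ (1 ⊗ a)Δ(b)`. -/
def comulL2 (Δ : A →ₗ[k] Multiplier k (A ⊗[k] A)) : A ⊗[k] A →ₗ[k] A ⊗[k] A :=
  descend (TensorProduct.lift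
    ((LinearMap.mul k (Multiplier k (A ⊗[k] A))).compl₁₂ (tens 1 ∘ₗ incl k A) Δ))

/-- `(A, Δ)` is a multiplier Hopf algebra (Van Daele): `A` is nondegenerate, `Δ : A → M(A ⊗ A)` is
a coassociative homomorphism with `Δ(a)(1 ⊗ b)` and `(a ⊗ 1)Δ(b)` in `A ⊗ A`, and the two
induced linear maps on `A ⊗ A` are bijective. -/
structure IsMultiplierHopf (Δ : A →ₗ[k] Multiplier k (A ⊗[k] A)) : Prop where
  nondegenerate : IsNondegenerate A
  map_mul : ∀ a b : A, Δ (a * b) = Δ a * Δ b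
  mem_right : ∀ a b : A, Δ a * tens 1 (incl k A b) ∈ LinearMap.range (incl k (A ⊗[k] A))
  mem_left : ∀ a b : A, tens (incl k A a) 1 * Δ b ∈ LinearMap.range (incl k (A ⊗[k] A))
  /-- `(a ⊗ 1 ⊗ 1)(Δ ⊗ ι)(Δ(b)(1 ⊗ c)) = (ι ⊗ Δ)((a ⊗ 1)Δ(b))(1 ⊗ 1 ⊗ c)`. -/
  coassoc : ∀ a b c : A,
    TensorProduct.assoc k A A A
      ((comulL1 Δ ∘ₗ TensorProduct.mk k A A a).rTensor A (comulR2 Δ (b ⊗ₜ c))) =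
    (comulR2 Δ ∘ₗ (TensorProduct.mk k A A).flip c).lTensor A (comulL1 Δ (a ⊗ₜ b))
  bijective_right : Function.Bijective (comulR2 Δ)
  bijective_left : Function.Bijective (comulL1 Δ)

/-- The flip `M(A ⊗ A) → M(A ⊗ A)` that extends `a ⊗ b ↦ b ⊗ a`. -/
def flipMultiplier : Multiplier k (A ⊗[k] A) →ₗ[k] Multiplier k (A ⊗[k] A) where
  toFun m := mkMultiplier
    ((TensorProduct.comm k A A).toLinearMap ∘ₗ lmul m ∘ₗ (TensorProduct.comm k A A).toLinearMap)
    ((TensorProduct.comm k A A).toLinearMap ∘ₗ rmul m ∘ₗ (TensorProduct.comm k A A).toLinearMap)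
    (by
      have hmul : ∀ x y : A ⊗[k] A, TensorProduct.comm k A A (x * y) =
          TensorProduct.comm k A A x * TensorProduct.comm k A A y := by
        intro x y
        induction x using TensorProduct.induction_on with
        | zero => simp
        | add x₁ x₂ h₁ h₂ => simp only [add_mul, map_add, h₁, h₂]
        | tmul b c =>
          induction y using TensorProduct.induction_on with
          | zero => simp
          | add y₁ y₂ h₁ h₂ => simp only [mul_add, map_add, h₁, h₂]
          | tmul b' c' => simp [Algebra.TensorProduct.tmul_mul_tmul]
      have hinv : ∀ x : A ⊗[k] A, TensorProduct.comm k A A (TensorProduct.comm k A A x) = x :=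
        fun x => (TensorProduct.comm k A A).symm_apply_apply x
      intro x y
      apply (TensorProduct.comm k A A).injective
      simp only [LinearMap.comp_apply, LinearEquiv.coe_coe, hmul, hinv]
      exact mul_lmul m _ _)
  map_add' m n := by
    apply multiplier_ext <;> intro x
    · exact map_add (TensorProduct.comm k A A) (lmul m _) (lmul n _)
    · exact map_add (TensorProduct.comm k A A) (rmul m _) (rmul n _)
  map_smul' r m := by
    apply multiplier_ext <;> intro x
    · exact map_smul (TensorProduct.comm k A A) r (lmul m _)
    · exact map_smul (TensorProduct.comm k A A) r (rmul m _)

/-- `(A, Δ)` is a regular multiplier Hopf algebra: both `(A, Δ)` and `(A, Δᶜᵒᵖ)` are multiplier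
Hopf algebras. -/
structure IsRegularMultiplierHopf (Δ : A →ₗ[k] Multiplier k (A ⊗[k] A)) : Prop where
  isMultiplierHopf : IsMultiplierHopf Δ
  isMultiplierHopf_cop : IsMultiplierHopf (flipMultiplier ∘ₗ Δ)

/-- `ε : A → k` is a counit of `(A, Δ)`. -/
structure IsCounit (Δ : A →ₗ[k] Multiplier k (A ⊗[k] A)) (ε : A →ₗ[k] k) : Prop where
  map_mul : ∀ a b : A, ε (a * b) = ε a * ε b
  left : ∀ a b : A, TensorProduct.lid k A (ε.rTensor A (comulR2 Δ (a ⊗ₜ b))) = a * b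
  right : ∀ a b : A, TensorProduct.rid k A (ε.lTensor A (comulL1 Δ (a ⊗ₜ b))) = a * b

/-- The counit of a multiplier Hopf algebra (which has exactly one). -/
def counit (Δ : A →ₗ[k] Multiplier k (A ⊗[k] A)) : A →ₗ[k] k := by
  classical
  exact if h : ∃ ε : A →ₗ[k] k, IsCounit Δ ε then h.choose else 0

end Hopf

/-! Coactions. -/

section Coaction

variable {k : Type*} [Field k]
variable {A : Type*} [NonUnitalRing A] [Module k A] [IsScalarTower k A A] [SMulCommClass k A A]
variable {Y : Type*} [NonUnitalRing Y] [Module k Y] [IsScalarTower k Y Y] [SMulCommClass k Y Y]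

/-- `T(y ⊗ a) = ρ(y)(a ⊗ 1)`. -/
def coactT (ρ : Y →ₗ[k] Multiplier k (A ⊗[k] Y)) : Y ⊗[k] A →ₗ[k] A ⊗[k] Y :=
  descend (TensorProduct.lift
    ((LinearMap.mul k (Multiplier k (A ⊗[k] Y))).compl₁₂ ρ (tens.flip 1 ∘ₗ incl k A)))

/-- `T̄(a ⊗ y) = (a ⊗ 1)ρ(y)`. -/
def coactTbar (ρ : Y →ₗ[k] Multiplier k (A ⊗[k] Y)) : A ⊗[k] Y →ₗ[k] A ⊗[k] Y :=
  descend (TensorProduct.lift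
    ((LinearMap.mul k (Multiplier k (A ⊗[k] Y))).compl₁₂ (tens.flip 1 ∘ₗ incl k A) ρ))

/-- `(ε ⊗ ι)` as the homomorphism `A ⊗ Y → M(Y)`, `a ⊗ y ↦ ε(a) y`. -/
def counitTensorId (ε : A →ₗ[k] k) : A ⊗[k] Y →ₗ[k] Multiplier k Y :=
  incl k Y ∘ₗ (TensorProduct.lid k Y).toLinearMap ∘ₗ ε.rTensor Y

/-- `(Δ ⊗ ι)` as the homomorphism `A ⊗ Y → M(A ⊗ A ⊗ Y)`, `a ⊗ y ↦ Δ(a) ⊗ y`. -/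
def comulTensorId (Δ : A →ₗ[k] Multiplier k (A ⊗[k] A)) :
    A ⊗[k] Y →ₗ[k] Multiplier k ((A ⊗[k] A) ⊗[k] Y) :=
  TensorProduct.lift (tens.compl₁₂ Δ (incl k Y))

/-- `Y` is a left `A`-comodule via `ρ`. -/
structure IsComodule (ΔA : A →ₗ[k] Multiplier k (A ⊗[k] A))
    (ρ : Y →ₗ[k] Multiplier k (A ⊗[k] Y)) : Prop where
  injective : Function.Injective ρ
  mem_right : ∀ (y : Y) (a : A),
    ρ y * tens (incl k A a) 1 ∈ LinearMap.range (incl k (A ⊗[k] Y))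
  mem_left : ∀ (y : Y) (a : A),
    tens (incl k A a) 1 * ρ y ∈ LinearMap.range (incl k (A ⊗[k] Y))
  /-- `(ι ⊗ ρ)(ρ(y)(a ⊗ 1))(1 ⊗ b ⊗ 1) = (Δ ⊗ ι)(ρ(y))(a ⊗ b ⊗ 1)`. -/
  coassoc_right : ∀ (y : Y) (a b : A),
    incl k ((A ⊗[k] A) ⊗[k] Y) ((TensorProduct.assoc k A A Y).symm
      ((coactT ρ ∘ₗ (TensorProduct.mk k Y A).flip b).lTensor A (coactT ρ (y ⊗ₜ a)))) =
    extend (comulTensorId ΔA) (ρ y) * tens (incl k (A ⊗[k] A) (a ⊗ₜ b)) 1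
  /-- `(1 ⊗ b ⊗ 1)(ι ⊗ ρ)((a ⊗ 1)ρ(y)) = (a ⊗ b ⊗ 1)(Δ ⊗ ι)(ρ(y))`. -/
  coassoc_left : ∀ (y : Y) (a b : A),
    incl k ((A ⊗[k] A) ⊗[k] Y) ((TensorProduct.assoc k A A Y).symm
      ((coactTbar ρ ∘ₗ TensorProduct.mk k A Y b).lTensor A (coactTbar ρ (a ⊗ₜ y)))) =
    tens (incl k (A ⊗[k] A) (a ⊗ₜ b)) 1 * extend (comulTensorId ΔA) (ρ y)

/-- `w ∈ Y ⊗ A ⊗ Y` equals `((ι ⊗ T)(Δ(y) ⊗ a))(1 ⊗ 1 ⊗ y')`, where `(ι ⊗ T)(Δ(y) ⊗ a)` is the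
multiplier (for the actions of `Y` on the first tensor factor of `Y ⊗ A ⊗ Y`) given by
`p ↦ (ι ⊗ T)(Δ(y)(p ⊗ 1) ⊗ a)` and `p ↦ (ι ⊗ T)((p ⊗ 1)Δ(y) ⊗ a)`. -/
structure IsCoverRight (ΔY : Y →ₗ[k] Multiplier k (Y ⊗[k] Y))
    (ρ : Y →ₗ[k] Multiplier k (A ⊗[k] Y)) (y : Y) (a : A) (y' : Y)
    (w : Y ⊗[k] (A ⊗[k] Y)) : Prop where
  right : ∀ p : Y, rmul (tens (incl k Y p) 1) w =
    rmul (tens 1 (tens 1 (incl k Y y'))) ((coactT ρ).lTensor Y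
      (TensorProduct.assoc k Y Y A (comulR1 ΔY (y ⊗ₜ p) ⊗ₜ a)))
  left : ∀ p : Y, lmul (tens (incl k Y p) 1) w =
    rmul (tens 1 (tens 1 (incl k Y y'))) ((coactT ρ).lTensor Y
      (TensorProduct.assoc k Y Y A (comulL1 ΔY (p ⊗ₜ y) ⊗ₜ a)))

/-- `w ∈ Y ⊗ A ⊗ Y` equals `(1 ⊗ 1 ⊗ y')((ι ⊗ T)(Δ(y) ⊗ a))`. -/
structure IsCoverLeft (ΔY : Y →ₗ[k] Multiplier k (Y ⊗[k] Y))
    (ρ : Y →ₗ[k] Multiplier k (A ⊗[k] Y)) (y : Y) (a : A) (y' : Y)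
    (w : Y ⊗[k] (A ⊗[k] Y)) : Prop where
  right : ∀ p : Y, rmul (tens (incl k Y p) 1) w =
    lmul (tens 1 (tens 1 (incl k Y y'))) ((coactT ρ).lTensor Y
      (TensorProduct.assoc k Y Y A (comulR1 ΔY (y ⊗ₜ p) ⊗ₜ a)))
  left : ∀ p : Y, lmul (tens (incl k Y p) 1) w =
    lmul (tens 1 (tens 1 (incl k Y y'))) ((coactT ρ).lTensor Y
      (TensorProduct.assoc k Y Y A (comulL1 ΔY (p ⊗ₜ y) ⊗ₜ a)))

/-- `((ι ⊗ T)(Δ(y) ⊗ a))(1 ⊗ 1 ⊗ y')` and `(1 ⊗ 1 ⊗ y')((ι ⊗ T)(Δ(y) ⊗ a))` lie in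
`Y ⊗ A ⊗ Y` for all `y`, `y'`, `a`. -/
def ComulCovered (ΔY : Y →ₗ[k] Multiplier k (Y ⊗[k] Y))
    (ρ : Y →ₗ[k] Multiplier k (A ⊗[k] Y)) : Prop :=
  ∀ (y : Y) (a : A) (y' : Y),
    (∃ w, IsCoverRight ΔY ρ y a y' w) ∧ (∃ w, IsCoverLeft ΔY ρ y a y' w)

/-- `(ι ⊗ Δ)T(y ⊗ a) = (T ⊗ ι)(ι ⊗ T)(Δ(y) ⊗ a)` for all `y`, `a`, as multipliers for the actions
of `Y` on the third tensor factor of `A ⊗ Y ⊗ Y`; the right side times `1 ⊗ 1 ⊗ y'` is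
`(T ⊗ ι)` of the element `((ι ⊗ T)(Δ(y) ⊗ a))(1 ⊗ 1 ⊗ y')`, and likewise on the left. -/
structure ComulCompatible (ΔY : Y →ₗ[k] Multiplier k (Y ⊗[k] Y))
    (ρ : Y →ₗ[k] Multiplier k (A ⊗[k] Y)) : Prop where
  right : ∀ (y : Y) (a : A) (y' : Y) (w : Y ⊗[k] (A ⊗[k] Y)), IsCoverRight ΔY ρ y a y' w →
    (comulR2 ΔY ∘ₗ (TensorProduct.mk k Y Y).flip y').lTensor A (coactT ρ (y ⊗ₜ a)) =
    TensorProduct.assoc k A Y Y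
      ((coactT ρ).rTensor Y ((TensorProduct.assoc k Y A Y).symm w))
  left : ∀ (y : Y) (a : A) (y' : Y) (w : Y ⊗[k] (A ⊗[k] Y)), IsCoverLeft ΔY ρ y a y' w →
    (comulL2 ΔY ∘ₗ TensorProduct.mk k Y Y y').lTensor A (coactT ρ (y ⊗ₜ a)) =
    TensorProduct.assoc k A Y Y
      ((coactT ρ).rTensor Y ((TensorProduct.assoc k Y A Y).symm w))

/-- `Y` is a (global) left `A`-comodule coalgebra via `ρ`. -/
structure IsComoduleCoalgebra (ΔA : A →ₗ[k] Multiplier k (A ⊗[k] A))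
    (ΔY : Y →ₗ[k] Multiplier k (Y ⊗[k] Y)) (ρ : Y →ₗ[k] Multiplier k (A ⊗[k] Y)) : Prop where
  isComodule : IsComodule ΔA ρ
  covered : ComulCovered ΔY ρ
  compatible : ComulCompatible ΔY ρ

/-- `(ι ⊗ T)(T ⊗ ι)(y ⊗ Δ(a))` times `1 ⊗ a' ⊗ 1`, that is
`(ι ⊗ T)(T ⊗ ι)(y ⊗ Δ(a)(1 ⊗ a'))`. -/
def iterT (ΔA : A →ₗ[k] Multiplier k (A ⊗[k] A)) (ρ : Y →ₗ[k] Multiplier k (A ⊗[k] Y))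
    (y : Y) (a a' : A) : A ⊗[k] (A ⊗[k] Y) :=
  (coactT ρ).lTensor A (TensorProduct.assoc k A Y A ((coactT ρ).rTensor A
    ((TensorProduct.assoc k Y A A).symm (y ⊗ₜ comulR2 ΔA (a ⊗ₜ a')))))

/-- `((ι ⊗ ε)T ⊗ ι ⊗ ι)(x ⊗ Δ(b)(1 ⊗ a') ⊗ v)` for `w = x ⊗ b ⊗ v`. -/
def counitT (ΔA : A →ₗ[k] Multiplier k (A ⊗[k] A)) (ΔY : Y →ₗ[k] Multiplier k (Y ⊗[k] Y))
    (ρ : Y →ₗ[k] Multiplier k (A ⊗[k] Y)) (a' : A) (w : Y ⊗[k] (A ⊗[k] Y)) :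
    A ⊗[k] (A ⊗[k] Y) :=
  TensorProduct.map
    ((TensorProduct.rid k A).toLinearMap ∘ₗ (counit ΔY).lTensor A ∘ₗ coactT ρ) LinearMap.id
    ((TensorProduct.assoc k Y A (A ⊗[k] Y)).symm
      ((TensorProduct.assoc k A A Y).toLinearMap.lTensor Y
        (((comulR2 ΔA ∘ₗ (TensorProduct.mk k A A).flip a').rTensor Y).lTensor Y w)))

/-- `Y` is a partial `A`-comodule coalgebra via `ρ`. -/
structure IsPartialComoduleCoalgebra (ΔA : A →ₗ[k] Multiplier k (A ⊗[k] A))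
    (ΔY : Y →ₗ[k] Multiplier k (Y ⊗[k] Y)) (ρ : Y →ₗ[k] Multiplier k (A ⊗[k] Y)) : Prop where
  mem_right : ∀ (y : Y) (a : A),
    ρ y * tens (incl k A a) 1 ∈ LinearMap.range (incl k (A ⊗[k] Y))
  counit_coact : ∀ y : Y, extend (counitTensorId (counit ΔA)) (ρ y) = incl k Y y
  covered : ComulCovered ΔY ρ
  compatible : ComulCompatible ΔY ρ
  /-- `(ι ⊗ T)(T ⊗ ι)(y ⊗ Δ(a)) = ((ι ⊗ ε)T ⊗ ι ⊗ ι)(ι ⊗ (Δ ⊗ ι)T)(Δ(y) ⊗ a)`, both sides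
  multiplied on the right by `1 ⊗ a' ⊗ y'`. -/
  coassoc : ∀ (y : Y) (a a' : A) (y' : Y) (w : Y ⊗[k] (A ⊗[k] Y)),
    IsCoverRight ΔY ρ y a y' w →
    rmul (tens 1 (tens 1 (incl k Y y'))) (iterT ΔA ρ y a a') = counitT ΔA ΔY ρ a' w

/-- `x ∈ A ⊗ Y ⊗ Y` equals `((T̄ ⊗ ι)(a ⊗ Δ(y)))(1 ⊗ y' ⊗ 1)`, where `(T̄ ⊗ ι)(a ⊗ Δ(y))` is the
multiplier (for the actions of `Y` on the third tensor factor of `A ⊗ Y ⊗ Y`) given by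
`q ↦ (T̄ ⊗ ι)(a ⊗ Δ(y)(1 ⊗ q))` and `q ↦ (T̄ ⊗ ι)(a ⊗ (1 ⊗ q)Δ(y))`. -/
structure IsCoverBar (ΔY : Y →ₗ[k] Multiplier k (Y ⊗[k] Y))
    (ρ : Y →ₗ[k] Multiplier k (A ⊗[k] Y)) (a : A) (y y' : Y)
    (x : A ⊗[k] (Y ⊗[k] Y)) : Prop where
  right : ∀ q : Y, rmul (tens 1 (tens 1 (incl k Y q))) x =
    rmul (tens 1 (tens (incl k Y y') 1)) (TensorProduct.assoc k A Y Y
      ((coactTbar ρ).rTensor Y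
        ((TensorProduct.assoc k A Y Y).symm (a ⊗ₜ comulR2 ΔY (y ⊗ₜ q)))))
  left : ∀ q : Y, lmul (tens 1 (tens 1 (incl k Y q))) x =
    rmul (tens 1 (tens (incl k Y y') 1)) (TensorProduct.assoc k A Y Y
      ((coactTbar ρ).rTensor Y
        ((TensorProduct.assoc k A Y Y).symm (a ⊗ₜ comulL2 ΔY (q ⊗ₜ y)))))

/-- `1 ⊗ b ⊗ 1` times `(ι ⊗ T̄)(ι ⊗ τ)(T̄ ⊗ ι)(ι ⊗ τ)(Δ(a) ⊗ y)`, that is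
`(ι ⊗ T̄)(ι ⊗ τ)(T̄ ⊗ ι)(ι ⊗ τ)((1 ⊗ b)Δ(a) ⊗ y)`. -/
def iterTbar (ΔA : A →ₗ[k] Multiplier k (A ⊗[k] A)) (ρ : Y →ₗ[k] Multiplier k (A ⊗[k] Y))
    (b a : A) (y : Y) : A ⊗[k] (A ⊗[k] Y) :=
  (coactTbar ρ).lTensor A ((TensorProduct.comm k Y A).toLinearMap.lTensor A
    (TensorProduct.assoc k A Y A ((coactTbar ρ).rTensor A
      ((TensorProduct.assoc k A Y A).symm ((TensorProduct.comm k A Y).toLinearMap.lTensor A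
        (TensorProduct.assoc k A A Y (comulL2 ΔA (b ⊗ₜ a) ⊗ₜ y)))))))

/-- `((ι ⊗ ε)T̄ ⊗ ι ⊗ ι)(ι ⊗ τ)((1 ⊗ b)Δ(c) ⊗ u ⊗ v)` for `x = c ⊗ u ⊗ v`, where
`τ : A ⊗ Y ⊗ Y → Y ⊗ A ⊗ Y` moves the last factor to the front. -/
def counitTbar (ΔA : A →ₗ[k] Multiplier k (A ⊗[k] A)) (ΔY : Y →ₗ[k] Multiplier k (Y ⊗[k] Y))
    (ρ : Y →ₗ[k] Multiplier k (A ⊗[k] Y)) (b : A) (x : A ⊗[k] (Y ⊗[k] Y)) :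
    A ⊗[k] (A ⊗[k] Y) :=
  TensorProduct.map
    ((TensorProduct.rid k A).toLinearMap ∘ₗ (counit ΔY).lTensor A ∘ₗ coactTbar ρ) LinearMap.id
    ((TensorProduct.assoc k A Y (A ⊗[k] Y)).symm
      ((TensorProduct.comm k (A ⊗[k] Y) Y).toLinearMap.lTensor A
        (TensorProduct.assoc k A (A ⊗[k] Y) Y
          ((TensorProduct.assoc k A A Y).toLinearMap.rTensor Y
            (((comulL2 ΔA ∘ₗ TensorProduct.mk k A A b).rTensor Y).rTensor Y
              ((TensorProduct.assoc k A Y Y).symm x))))))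

/-- `Y` is a symmetric partial `A`-comodule coalgebra via `ρ`. -/
structure IsSymmetricPartialComoduleCoalgebra (ΔA : A →ₗ[k] Multiplier k (A ⊗[k] A))
    (ΔY : Y →ₗ[k] Multiplier k (Y ⊗[k] Y)) (ρ : Y →ₗ[k] Multiplier k (A ⊗[k] Y)) : Prop where
  isPartial : IsPartialComoduleCoalgebra ΔA ΔY ρ
  mem_left : ∀ (y : Y) (a : A),
    tens (incl k A a) 1 * ρ y ∈ LinearMap.range (incl k (A ⊗[k] Y))
  coveredBar : ∀ (a : A) (y y' : Y), ∃ x, IsCoverBar ΔY ρ a y y' x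
  /-- `(ι ⊗ T̄)(ι ⊗ τ)(T̄ ⊗ ι)(ι ⊗ τ)(Δ(a) ⊗ y) =
  ((ι ⊗ ε)T̄ ⊗ ι ⊗ ι)(ι ⊗ τ)((Δ ⊗ ι)T̄ ⊗ ι)(a ⊗ Δ(y))`, both sides multiplied on the left by
  `1 ⊗ b ⊗ 1` and on the right by `1 ⊗ 1 ⊗ y'`. -/
  coassocBar : ∀ (a b : A) (y y' : Y) (x : A ⊗[k] (Y ⊗[k] Y)),
    IsCoverBar ΔY ρ a y y' x →
    rmul (tens 1 (tens 1 (incl k Y y'))) (iterTbar ΔA ρ b a y) = counitTbar ΔA ΔY ρ b x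

end Coaction

end

end MultHopf

/-! Conditions (1), (3), (4) belong to both notions, so the content is (5), (6), (7), (8). They rest
on two facts: `T` is a bijection `Y ⊗ A → A ⊗ Y`, and `(ι ⊗ ε_Y)T = ε_Y ⊗ ι`.

Bijectivity. Applying `ε_A` to the first leg of the coassociativity of `ρ`, and using that `ρ` is
injective, gives `(ε_A ⊗ ι)T(y ⊗ a) = ε_A(a)y` (`counit_T`) and hence (5). Write `L(a ⊗ b) = (a ⊗
1)Δ_A(b)`. The antipode `S` of `A` is needed only through the products `aS(b) = (ι ⊗ ε_A)L⁻¹(a ⊗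
b)`, which span `A`. Transporting the coassociativity of `ρ` through `L⁻¹` shows that `T̄` is
injective (`injective_S`). Passing to opposite multiplications exchanges `T` and `T̄`, so `T` is
injective too. Once one of them is injective, the identity `T̄((aS(·) ⊗ ι)T(y ⊗ b)) = aS(b) ⊗ y`
(`S_mulAntipode_T`) makes the other one surjective. Together this is `bijective_coactT`.

The counit of `Y`. Condition (4), read through `T⁻¹`, says that `T⁻¹` on the first two legs of `c ⊗
Δ_Y(u)(1 ⊗ y')` is the covered element `w` of (3) that belongs to `T⁻¹(c ⊗ u)`. Its image under
`ε_Y` on the first leg is `T(T⁻¹(c ⊗ u))(1 ⊗ y') = c ⊗ uy'`. Since the elements `Δ_Y(u)(1 ⊗ y')`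
span `Y ⊗ Y`, this forces `(ε_Y ⊗ ι)T⁻¹ = ι ⊗ ε_Y` (`evalRight_coactT`). The relation between `T`
and `T̄` then gives `(ι ⊗ ε_Y)T̄ = ι ⊗ ε_Y`.

Consequently the right sides of (6) and (8) collapse to `Δ_A ⊗ ι` applied to `T(y ⊗ a)` and `T̄(a ⊗
y)`, and both conditions become the coassociativity of `ρ`. For (7), the antipode identity expresses
`T̄` at `aS(c) ⊗ u` through `T⁻¹(c ⊗ u)`, and (4) in the form above turns a covering on the third
leg into one on the first (`coveredBar`). -/

namespace MultHopf

open TensorProduct (mk lift assoc)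

/-! ### Slicing and cancellation in tensor products over a field -/

section LinearAlgebra

variable {k : Type*} [Field k]
variable {A B C U V W : Type*} [AddCommGroup A] [Module k A] [AddCommGroup B] [Module k B]
  [AddCommGroup C] [Module k C]
  [AddCommGroup U] [Module k U] [AddCommGroup V] [Module k V] [AddCommGroup W] [Module k W]

/-- Apply a functional to the first tensor factor. -/
noncomputable def evalLeft (ε : A →ₗ[k] k) : A ⊗[k] V →ₗ[k] V :=
  (TensorProduct.lid k V).toLinearMap ∘ₗ ε.rTensor V

/-- Apply a functional to the second tensor factor. -/
noncomputable def evalRight (ε : A →ₗ[k] k) : V ⊗[k] A →ₗ[k] V :=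
  (TensorProduct.rid k V).toLinearMap ∘ₗ ε.lTensor V

@[simp] theorem evalLeft_tmul (ε : A →ₗ[k] k) (a : A) (v : V) :
    evalLeft ε (a ⊗ₜ[k] v) = ε a • v := by simp [evalLeft]

@[simp] theorem evalRight_tmul (ε : A →ₗ[k] k) (a : A) (v : V) :
    evalRight ε (v ⊗ₜ[k] a) = ε a • v := by simp [evalRight]

theorem evalLeft_lTensor (ε : A →ₗ[k] k) (f : V →ₗ[k] W) (t : A ⊗[k] V) :
    evalLeft ε (f.lTensor A t) = f (evalLeft ε t) := by
  induction t using TensorProduct.induction_on with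
  | zero => simp
  | add x y hx hy => simp only [map_add, hx, hy]
  | tmul a v => simp

theorem evalRight_rTensor (ε : A →ₗ[k] k) (f : V →ₗ[k] W) (t : V ⊗[k] A) :
    evalRight ε (f.rTensor A t) = f (evalRight ε t) := by
  induction t using TensorProduct.induction_on with
  | zero => simp
  | add x y hx hy => simp only [map_add, hx, hy]
  | tmul a v => simp

theorem evalLeft_rTensor (ε : A →ₗ[k] k) (f : A →ₗ[k] A) (c : k) (hf : ∀ x, ε (f x) = c * ε x)
    (t : A ⊗[k] V) : evalLeft ε (f.rTensor V t) = c • evalLeft ε t := by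
  induction t using TensorProduct.induction_on with
  | zero => simp
  | add x y hx hy => simp only [map_add, smul_add, hx, hy]
  | tmul x y => simp [hf, mul_smul]

theorem evalRight_lTensor (ε : A →ₗ[k] k) (f : A →ₗ[k] A) (c : k) (hf : ∀ x, ε (f x) = c * ε x)
    (t : V ⊗[k] A) : evalRight ε (f.lTensor V t) = c • evalRight ε t := by
  induction t using TensorProduct.induction_on with
  | zero => simp
  | add x y hx hy => simp only [map_add, smul_add, hx, hy]
  | tmul x y => simp [hf, mul_smul]

theorem evalLeft_assoc (ε : A →ₗ[k] k) (t : (A ⊗[k] V) ⊗[k] W) :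
    evalLeft ε (assoc k A V W t) = (evalLeft ε).rTensor W t := by
  refine LinearMap.congr_fun (f := evalLeft ε ∘ₗ (assoc k A V W).toLinearMap) ?_ t
  ext a v w
  simp [TensorProduct.smul_tmul']

theorem evalRight_rTensor_assoc_symm (ε : A →ₗ[k] k) (t : V ⊗[k] (A ⊗[k] W)) :
    (evalRight ε).rTensor W ((assoc k V A W).symm t) = (evalLeft ε).lTensor V t := by
  refine LinearMap.congr_fun
    (f := (evalRight ε).rTensor W ∘ₗ (assoc k V A W).symm.toLinearMap) ?_ t
  ext a v w
  simp [TensorProduct.smul_tmul']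

/-- The coordinate functionals of a basis of `V` already separate the elements of `U ⊗ V`. -/
theorem eq_zero_of_evalRight (z : U ⊗[k] V) (h : ∀ ψ : V →ₗ[k] k, evalRight ψ z = 0) :
    z = 0 := by
  classical
  let b := Module.Basis.ofVectorSpace k V
  apply (TensorProduct.equivFinsuppOfBasisRight (M := U) b).injective
  rw [map_zero]
  ext i
  have key : ∀ z : U ⊗[k] V, TensorProduct.equivFinsuppOfBasisRight b z i =
      evalRight (b.coord i) z := by
    intro z
    induction z using TensorProduct.induction_on with
    | zero => simp
    | add x y hx hy => simp only [map_add, Finsupp.add_apply, hx, hy]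
    | tmul a v => simp
  rw [key, h]
  rfl

/-- Flatness handles a single injective map; here the family may be infinite and only its common
kernel vanishes. Slicing by functionals on `V` reduces to `U`. This is how nondegeneracy of a
product is used inside one leg of a tensor product. -/
theorem rTensor_jointly_injective {ι : Type*} (f : ι → U →ₗ[k] W)
    (h : ∀ u, (∀ i, f i u = 0) → u = 0) (z : U ⊗[k] V) (hz : ∀ i, (f i).rTensor V z = 0) :
    z = 0 :=
  eq_zero_of_evalRight z fun ψ => h _ fun i => by
    rw [← evalRight_rTensor, hz, map_zero]

theorem lTensor_jointly_injective {ι : Type*} (f : ι → U →ₗ[k] W)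
    (h : ∀ u, (∀ i, f i u = 0) → u = 0) (z : V ⊗[k] U) (hz : ∀ i, (f i).lTensor V z = 0) :
    z = 0 := by
  apply (TensorProduct.comm k V U).injective
  rw [map_zero]
  refine rTensor_jointly_injective f h _ fun i => ?_
  have key : ∀ z : V ⊗[k] U, (f i).rTensor V (TensorProduct.comm k V U z) =
      TensorProduct.comm k V W ((f i).lTensor V z) := by
    intro z
    induction z using TensorProduct.induction_on with
    | zero => simp
    | add x y hx hy => simp only [map_add, hx, hy]
    | tmul a v => simp
  rw [key, hz, map_zero]

theorem tmul_right_cancel {u u' : U} (v : V) (hv : v ≠ 0) (h : u ⊗ₜ[k] v = u' ⊗ₜ[k] v) :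
    u = u' := by
  obtain ⟨f, hf⟩ := Module.Projective.exists_dual_eq_one k hv
  simpa [hf] using congrArg (evalRight f) h

theorem rTensor_assoc (f : U →ₗ[k] A) (t : (U ⊗[k] V) ⊗[k] W) :
    f.rTensor (V ⊗[k] W) (assoc k U V W t) =
      assoc k A V W ((f.rTensor V).rTensor W t) := by
  refine LinearMap.congr_fun
    (f := f.rTensor (V ⊗[k] W) ∘ₗ (assoc k U V W).toLinearMap)
    (g := (assoc k A V W).toLinearMap ∘ₗ (f.rTensor V).rTensor W) ?_ t
  ext; simp

theorem lTensor_rTensor_assoc (f : V →ₗ[k] A) (t : (U ⊗[k] V) ⊗[k] W) :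
    (f.rTensor W).lTensor U (assoc k U V W t) =
      assoc k U A W ((f.lTensor U).rTensor W t) := by
  refine LinearMap.congr_fun
    (f := (f.rTensor W).lTensor U ∘ₗ (assoc k U V W).toLinearMap)
    (g := (assoc k U A W).toLinearMap ∘ₗ (f.lTensor U).rTensor W) ?_ t
  ext; simp

theorem lTensor_lTensor_assoc (f : W →ₗ[k] A) (t : (U ⊗[k] V) ⊗[k] W) :
    (f.lTensor V).lTensor U (assoc k U V W t) =
      assoc k U V A (f.lTensor (U ⊗[k] V) t) := by
  refine LinearMap.congr_fun
    (f := (f.lTensor V).lTensor U ∘ₗ (assoc k U V W).toLinearMap)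
    (g := (assoc k U V A).toLinearMap ∘ₗ f.lTensor (U ⊗[k] V)) ?_ t
  ext; simp

/-- Maps acting on different tensor factors commute. -/
theorem lTensor_rTensor_comm (f : U →ₗ[k] A) (g : V →ₗ[k] B) (t : U ⊗[k] V) :
    g.lTensor A (f.rTensor V t) = f.rTensor B (g.lTensor U t) := by
  rw [← LinearMap.comp_apply, ← LinearMap.comp_apply, LinearMap.lTensor_comp_rTensor,
    LinearMap.rTensor_comp_lTensor]

end LinearAlgebra
end MultHopf

namespace MultHopf
noncomputable section
-- Bijectivity of the coaction operators, by means of the antipode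
open TensorProduct (lift assoc)

/-- The operators `L(a, b) = (a ⊗ 1)Δ(b)`, `R(a, b) = Δ(a)(1 ⊗ b)`, `T(y, a) = ρ(y)(a ⊗ 1)`,
`S(y, a) = (a ⊗ 1)ρ(y)` of a coaction, together with the identities that relate them. These are
invariant under passing to opposite multiplications, which exchanges `T` and `S`. -/
structure CoactionOperators (k A Y : Type*) [Field k] [AddCommGroup A] [Module k A]
    [AddCommGroup Y] [Module k Y] where
  m : A →ₗ[k] A →ₗ[k] A
  L : A →ₗ[k] A →ₗ[k] A ⊗[k] A
  R : A →ₗ[k] A →ₗ[k] A ⊗[k] A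
  ε : A →ₗ[k] k
  T : Y →ₗ[k] A →ₗ[k] A ⊗[k] Y
  S : Y →ₗ[k] A →ₗ[k] A ⊗[k] Y
  nondegenerate : ∀ a, (∀ b, m a b = 0) → a = 0
  bijective_L : Function.Bijective (lift L)
  surjective_R : Function.Surjective (lift R)
  counit_mul : ∀ a b, ε (m a b) = ε a * ε b
  counit_R : ∀ a b, evalLeft ε (R a b) = m a b
  coassoc : ∀ a b c, assoc k A A A ((L a).rTensor A (R b c)) = (R.flip c).lTensor A (L a b)
  L_mul : ∀ a b c, L a (m b c) =
    lift ((LinearMap.lTensorHom A ∘ₗ m).flip ∘ₗ L.flip c) (L a b)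
  T_mul : ∀ y a b, T y (m a b) = (m.flip b).rTensor Y (T y a)
  L_R : ∀ a b c, (m.flip c).lTensor A (L a b) = (m a).rTensor A (R b c)
  S_T : ∀ a y b, (m.flip b).rTensor Y (S y a) = (m a).rTensor Y (T y b)
  pentagon_T : ∀ y a b, lift ((LinearMap.lTensorHom A ∘ₗ T.flip).flip ∘ₗ T y) (R a b) =
    assoc k A A Y ((R.flip b).rTensor Y (T y a))
  pentagon_S : ∀ y a b, lift ((LinearMap.lTensorHom A ∘ₗ S.flip).flip ∘ₗ S y) (L a b) =
    assoc k A A Y ((L a).rTensor Y (S y b))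
  faithful : ∀ y, (∀ a, T y a = 0) → y = 0

namespace CoactionOperators

variable {k A Y : Type*} [Field k] [AddCommGroup A] [Module k A] [AddCommGroup Y] [Module k Y]
variable (D : CoactionOperators k A Y)

/-- Apply `ε` to the first leg of `pentagon_T`. With `E(y, a) = (ε ⊗ ι)T(y, a)`, the left side is
`T(E(y, ·), ·)` at `R(a, b)`; the right side is `T(y, ab)`, which is `T(y, ·)` of `(ε ⊗ ι)R(a, b)`.
As the `R(a, b)` span `A ⊗ A`, this gives `T(E(y, a), e) = ε(a)T(y, e)` for all `e`, and
faithfulness concludes. -/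
theorem counit_T (y : Y) (a : A) : evalLeft D.ε (D.T y a) = D.ε a • y := by
  rw [← sub_eq_zero]
  refine D.faithful _ fun e => ?_
  rw [map_sub, map_smul, LinearMap.sub_apply, LinearMap.smul_apply, sub_eq_zero]
  have h1 : ∀ r : A ⊗[k] A, evalLeft D.ε
      (lift ((LinearMap.lTensorHom A ∘ₗ D.T.flip).flip ∘ₗ D.T y) r) =
      lift (D.T ∘ₗ evalLeft D.ε ∘ₗ D.T y) r := by
    intro r
    induction r using TensorProduct.induction_on with
    | zero => simp
    | add x y hx hy => simp only [map_add, hx, hy]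
    | tmul x e => simp [evalLeft_lTensor]
  have h2 : lift (D.T ∘ₗ evalLeft D.ε ∘ₗ D.T y) = D.T y ∘ₗ evalLeft D.ε := by
    refine LinearMap.ext fun r => ?_
    obtain ⟨r, rfl⟩ := D.surjective_R r
    induction r using TensorProduct.induction_on with
    | zero => simp
    | add x y hx hy => simp only [map_add, hx, hy]
    | tmul c d =>
      rw [TensorProduct.lift.tmul, ← h1, D.pentagon_T, evalLeft_assoc,
        ← LinearMap.rTensor_comp_apply, LinearMap.comp_apply, D.counit_R, D.T_mul]
      congr 2
      ext x
      simp [D.counit_R]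
  simpa using LinearMap.congr_fun h2 (a ⊗ₜ e)

theorem exists_counit_ne_zero [Nontrivial A] : ∃ a, D.ε a ≠ 0 := by
  by_contra! h
  have h0 : D.ε = 0 := LinearMap.ext h
  obtain ⟨a, ha⟩ := exists_ne (0 : A)
  refine ha (D.nondegenerate a fun b => ?_)
  rw [← D.counit_R, h0]
  simp [evalLeft]

theorem counit_S (y : Y) (a : A) : evalLeft D.ε (D.S y a) = D.ε a • y := by
  cases subsingleton_or_nontrivial A with
  | inl h => simp [Subsingleton.elim a 0]
  | inr h =>
    obtain ⟨b, hb⟩ := D.exists_counit_ne_zero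
    have h1 : ∀ t : A ⊗[k] Y, evalLeft D.ε ((D.m.flip b).rTensor Y t) =
        D.ε b • evalLeft D.ε t := by
      intro t
      induction t using TensorProduct.induction_on with
      | zero => simp
      | add x y hx hy => simp only [map_add, hx, hy, smul_add]
      | tmul x y => simp [D.counit_mul, mul_smul, smul_comm (D.ε x)]
    have h2 : ∀ t : A ⊗[k] Y, evalLeft D.ε ((D.m a).rTensor Y t) =
        D.ε a • evalLeft D.ε t := by
      intro t
      induction t using TensorProduct.induction_on with
      | zero => simp
      | add x y hx hy => simp only [map_add, hx, hy, smul_add]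
      | tmul x y => simp [D.counit_mul, mul_smul]
    have h3 := congrArg (evalLeft D.ε) (D.S_T a y b)
    rw [h1, h2, counit_T, smul_comm] at h3
    exact smul_right_injective Y hb h3

/-- The bijection `a ⊗ b ↦ L(a, b)`. -/
def Lequiv : A ⊗[k] A ≃ₗ[k] A ⊗[k] A := LinearEquiv.ofBijective (lift D.L) D.bijective_L

theorem Lequiv_apply (z : A ⊗[k] A) : D.Lequiv z = lift D.L z := rfl

/-- `a S(b)`, where `S` is the antipode. -/
def mulAntipode : A →ₗ[k] A →ₗ[k] A :=
  (TensorProduct.mk k A A).compr₂ (evalRight D.ε ∘ₗ D.Lequiv.symm.toLinearMap)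

theorem mulAntipode_apply (a b : A) :
    D.mulAntipode a b = evalRight D.ε (D.Lequiv.symm (a ⊗ₜ b)) := rfl

/-- The map is `(ι ⊗ ε)L⁻¹`, and `ε` is nonzero when `A` is. -/
theorem lift_mulAntipode_surjective [Nontrivial A] :
    Function.Surjective (lift D.mulAntipode) := by
  have h : lift D.mulAntipode = evalRight D.ε ∘ₗ D.Lequiv.symm.toLinearMap := by
    ext; simp [mulAntipode]
  rw [h, LinearMap.coe_comp]
  refine Function.Surjective.comp (fun a => ?_) D.Lequiv.symm.surjective
  obtain ⟨b, hb⟩ := D.exists_counit_ne_zero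
  exact ⟨(D.ε b)⁻¹ • (a ⊗ₜ b), by simp [hb]⟩

/-- Coassociativity as a commutation relation: `L` on the first two legs commutes with `R(·, c)` on
the second factor. In this form `L` can be inverted. -/
theorem coassoc_lift (z : A ⊗[k] A) (c : A) :
    (lift D.L).rTensor A ((assoc k A A A).symm ((D.R.flip c).lTensor A z)) =
      (assoc k A A A).symm ((D.R.flip c).lTensor A (lift D.L z)) := by
  induction z using TensorProduct.induction_on with
  | zero => simp
  | add x y hx hy => simp only [map_add, hx, hy]
  | tmul a b =>
    rw [TensorProduct.lift.tmul, ← D.coassoc, LinearEquiv.symm_apply_apply,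
      LinearMap.lTensor_tmul, LinearMap.flip_apply]
    induction D.R b c using TensorProduct.induction_on with
    | zero => simp
    | add x y hx hy => simp only [map_add, TensorProduct.tmul_add, hx, hy]
    | tmul x y => simp

/-- In Sweedler notation `L⁻¹(a ⊗ b) = aS(b₁) ⊗ b₂`; the factor `c` covers the second leg. Apply
`L⁻¹` to the first two legs of `coassoc_lift`, then `ε` to the middle leg, where `(ε ⊗ ι)R(·, c)` is
multiplication by `c`. -/
theorem Lequiv_symm_mul (a b c : A) :
    (D.m.flip c).lTensor A (D.Lequiv.symm (a ⊗ₜ b)) =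
      (D.mulAntipode a).rTensor A (D.R b c) := by
  have h1 := D.coassoc_lift (D.Lequiv.symm (a ⊗ₜ b)) c
  rw [← D.Lequiv_apply, LinearEquiv.apply_symm_apply] at h1
  have h2 : D.Lequiv.symm.toLinearMap ∘ₗ lift D.L = LinearMap.id :=
    LinearMap.ext D.Lequiv.symm_apply_apply
  have h3 := congrArg ((evalRight D.ε ∘ₗ D.Lequiv.symm.toLinearMap).rTensor A) h1
  rw [← LinearMap.rTensor_comp_apply, LinearMap.comp_assoc, h2, LinearMap.comp_id,
    evalRight_rTensor_assoc_symm, ← LinearMap.lTensor_comp_apply] at h3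
  have h4 : evalLeft D.ε ∘ₗ D.R.flip c = D.m.flip c := by
    ext x; simp [D.counit_R]
  rw [h4] at h3
  rw [h3, LinearMap.lTensor_tmul, LinearMap.flip_apply]
  induction D.R b c using TensorProduct.induction_on with
  | zero => simp
  | add x y hx hy => simp only [map_add, TensorProduct.tmul_add, hx, hy]
  | tmul x y => simp [mulAntipode]

theorem eq_zero_of_mulAntipode (a : A) (h : ∀ b, D.mulAntipode a b = 0) : a = 0 := by
  by_contra ha
  have h0 : D.mulAntipode a = 0 := LinearMap.ext h
  -- By `Lequiv_symm_mul`, `L⁻¹(a ⊗ b)` vanishes for every `b`. The choice `b = a` suffices, since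
  -- `a ⊗ a = 0` forces `a = 0`.
  have h1 : D.Lequiv.symm (a ⊗ₜ a) = 0 := by
    refine lTensor_jointly_injective D.m.flip (fun x hx => D.nondegenerate x fun b => ?_) _
      fun c => ?_
    · exact hx b
    · rw [Lequiv_symm_mul, h0]; simp
  have h2 : a ⊗ₜ[k] a = (0 : A) ⊗ₜ[k] a := by
    simpa using h1
  exact ha (tmul_right_cancel a ha h2)

theorem Lequiv_rTensor (y : Y) (p : A ⊗[k] A) :
    D.Lequiv.toLinearMap.rTensor Y ((assoc k A A Y).symm ((D.S y).lTensor A p)) =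
      (assoc k A A Y).symm
        (lift ((LinearMap.lTensorHom A ∘ₗ D.S.flip).flip ∘ₗ D.S y) (D.Lequiv p)) := by
  induction p using TensorProduct.induction_on with
  | zero => simp
  | add x y hx hy => simp only [map_add, hx, hy]
  | tmul a b =>
    rw [Lequiv_apply, TensorProduct.lift.tmul, D.pentagon_S, LinearEquiv.symm_apply_apply,
      LinearMap.lTensor_tmul]
    induction D.S y b using TensorProduct.induction_on with
    | zero => simp
    | add x y hx hy => simp only [map_add, TensorProduct.tmul_add, hx, hy]
    | tmul x y => simp [Lequiv_apply]

/-- For `z = Σ a ⊗ y` put `u = Σ (ι ⊗ S(y, ·))L⁻¹(a ⊗ b)`. By `pentagon_S`, `L` on the first two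
legs sends `u` to `S(·, b)` applied to the second leg of `Σ S(y, a)`, so `u = 0` as soon as `Σ S(y,
a) = 0`. But `ε` on the middle leg of `u` gives `Σ aS(b) ⊗ y` by `counit_S` (here `S(b)` is the
antipode), and no nonzero `a` is killed by all `S(b)`. -/
theorem injective_S : Function.Injective (lift D.S.flip) := by
  rw [injective_iff_map_eq_zero]
  intro z hz
  refine rTensor_jointly_injective D.mulAntipode.flip D.eq_zero_of_mulAntipode z fun b => ?_
  have key : ∀ z : A ⊗[k] Y, ∃ u : A ⊗[k] (A ⊗[k] Y),
      D.Lequiv.toLinearMap.rTensor Y ((assoc k A A Y).symm u) =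
        (assoc k A A Y).symm ((D.S.flip b).lTensor A (lift D.S.flip z)) ∧
      (evalLeft D.ε).lTensor A u = (D.mulAntipode.flip b).rTensor Y z := by
    intro z
    induction z using TensorProduct.induction_on with
    | zero => exact ⟨0, by simp, by simp⟩
    | add x y hx hy =>
      obtain ⟨u, hu, hu'⟩ := hx
      obtain ⟨v, hv, hv'⟩ := hy
      exact ⟨u + v, by simp only [map_add, hu, hv], by simp only [map_add, hu', hv']⟩
    | tmul a y =>
      refine ⟨(D.S y).lTensor A (D.Lequiv.symm (a ⊗ₜ b)), ?_, ?_⟩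
      · rw [Lequiv_rTensor, LinearEquiv.apply_symm_apply]
        rfl
      · rw [LinearMap.rTensor_tmul, LinearMap.flip_apply, mulAntipode_apply]
        induction D.Lequiv.symm (a ⊗ₜ b) using TensorProduct.induction_on with
        | zero => simp
        | add x y hx hy => simp only [map_add, TensorProduct.add_tmul, hx, hy]
        | tmul x y' => simp [counit_S, TensorProduct.smul_tmul]
  obtain ⟨u, hu, hu'⟩ := key z
  have hu0 : D.Lequiv.toLinearMap.rTensor Y ((assoc k A A Y).symm u) = 0 := by
    rw [hu, hz]; simp
  have h3 := congrArg (D.Lequiv.symm.toLinearMap.rTensor Y) hu0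
  rw [← LinearMap.rTensor_comp_apply] at h3
  have h2 : D.Lequiv.symm.toLinearMap ∘ₗ D.Lequiv.toLinearMap = LinearMap.id :=
    LinearMap.ext D.Lequiv.symm_apply_apply
  rw [h2, LinearMap.rTensor_id_apply, map_zero, LinearEquiv.map_eq_zero_iff] at h3
  rw [← hu', h3, map_zero]

/-- Both sides stand for `(a ⊗ 1 ⊗ 1)(Δ ⊗ ι)(ρ(y))(Δ(b) ⊗ 1)`, with `(Δ ⊗ ι)ρ(y)` rewritten as `(ι ⊗
ρ)ρ(y)` on the right. -/
theorem mixed_pentagon (y : Y) (a b : A) :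
    assoc k A A Y ((D.L a).rTensor Y (D.T y b)) =
      lift ((LinearMap.lTensorHom A ∘ₗ D.T).flip ∘ₗ D.L.flip b) (D.S y a) := by
  rw [← sub_eq_zero]
  -- Multiplying the second leg by `d` on the right turns `L(a, ·)` into `a · R(·, d)`, so that
  -- `pentagon_T` applies; nondegeneracy then cancels `d`.
  refine lTensor_jointly_injective (fun d => (D.m.flip d).rTensor Y)
    (fun u hu => rTensor_jointly_injective D.m.flip (fun x hx => D.nondegenerate x hx) u hu) _
    fun d => ?_
  rw [map_sub, sub_eq_zero, lTensor_rTensor_assoc, ← LinearMap.rTensor_comp_apply]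
  have h1 : (D.m.flip d).lTensor A ∘ₗ D.L a = (D.m a).rTensor A ∘ₗ D.R.flip d :=
    LinearMap.ext fun x => D.L_R a x d
  rw [h1, LinearMap.rTensor_comp_apply, ← rTensor_assoc]
  change (D.m a).rTensor (A ⊗[k] Y) (assoc k A A Y ((D.R.flip d).rTensor Y (D.T y b))) = _
  rw [← D.pentagon_T]
  have h2 : ∀ r : A ⊗[k] A, (D.m a).rTensor (A ⊗[k] Y)
      (lift ((LinearMap.lTensorHom A ∘ₗ D.T.flip).flip ∘ₗ D.T y) r) =
      lift ((LinearMap.lTensorHom A ∘ₗ D.T).flip ∘ₗ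
        ((LinearMap.rTensorHom A ∘ₗ D.m).flip r)) (D.S y a) := by
    intro r
    induction r using TensorProduct.induction_on with
    | zero =>
      generalize D.S y a = t
      induction t using TensorProduct.induction_on with
      | zero => simp
      | add x y hx hy => rw [map_add, ← hx, ← hy]; simp
      | tmul x y => simp
    | add p q hp hq =>
      rw [map_add, map_add, hp, hq, map_add, LinearMap.comp_add]
      generalize D.S y a = t
      induction t using TensorProduct.induction_on with
      | zero => simp
      | add x y hx hy => simp only [map_add, ← hx, ← hy]; abel
      | tmul x y => simp
    | tmul e f =>
      have h3 : ∀ t : A ⊗[k] Y, lift ((LinearMap.lTensorHom A ∘ₗ D.T).flip ∘ₗ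
          ((LinearMap.rTensorHom A ∘ₗ D.m).flip (e ⊗ₜ f))) t =
          (D.T.flip f).lTensor A ((D.m.flip e).rTensor Y t) := by
        intro t
        induction t using TensorProduct.induction_on with
        | zero => simp
        | add x y hx hy => simp only [map_add, hx, hy]
        | tmul x y => simp
      rw [h3, D.S_T, lTensor_rTensor_comm]
      rfl
  rw [h2]
  generalize D.S y a = t
  induction t using TensorProduct.induction_on with
  | zero => simp
  | add x y hx hy => simp only [map_add, hx, hy]
  | tmul c u =>
    have h3 := D.L_R c b d
    simp only [TensorProduct.lift.tmul, LinearMap.comp_apply, LinearMap.flip_apply,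
      LinearMap.coe_lTensorHom, LinearMap.coe_rTensorHom]
    rw [← h3, ← LinearMap.lTensor_comp_apply, ← LinearMap.lTensor_comp_apply]
    congr 2
    ext x
    simp [D.T_mul]

/-- `(a ⊗ y) ⊗ b ↦ (ι ⊗ T(y, ·))L(a, b)`. -/
def twist : (A ⊗[k] Y) ⊗[k] A →ₗ[k] A ⊗[k] (A ⊗[k] Y) :=
  (lift D.T).lTensor A ∘ₗ (TensorProduct.comm k A Y).toLinearMap.lTensor A ∘ₗ
    (assoc k A A Y).toLinearMap ∘ₗ D.Lequiv.toLinearMap.rTensor Y ∘ₗ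
    (TensorProduct.rightComm k A Y A).toLinearMap

/-- Up to permutations of legs, `twist` is `L` followed by `T`, each on two of the three legs. It
serves to test equalities of elements of the form `S(z)`, because `mixed_pentagon` computes it
there. -/
theorem twist_injective (hT : Function.Injective (lift D.T)) : Function.Injective D.twist := by
  unfold twist
  simp only [LinearMap.coe_comp, LinearEquiv.coe_coe]
  refine (Module.Flat.lTensor_preserves_injective_linearMap _ hT).comp
    ((Module.Flat.lTensor_preserves_injective_linearMap _ (LinearEquiv.injective _)).comp
    ((LinearEquiv.injective _).comp
    ((Module.Flat.rTensor_preserves_injective_linearMap _ D.Lequiv.injective).comp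
    (LinearEquiv.injective _))))

theorem twist_tmul_tmul (a b : A) (y : Y) :
    D.twist ((a ⊗ₜ y) ⊗ₜ b) = (D.T y).lTensor A (D.L a b) := by
  simp only [twist, LinearMap.comp_apply, LinearEquiv.coe_coe, TensorProduct.rightComm_tmul,
    LinearMap.rTensor_tmul, Lequiv_apply, TensorProduct.lift.tmul]
  induction D.L a b using TensorProduct.induction_on with
  | zero => simp
  | add x y hx hy => simp only [map_add, TensorProduct.add_tmul, hx, hy]
  | tmul x y => simp

theorem twist_S (z : A ⊗[k] Y) (b : A) :
    D.twist (lift D.S.flip z ⊗ₜ b) = assoc k A A Y (D.Lequiv.toLinearMap.rTensor Y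
      ((assoc k A A Y).symm ((D.T.flip b).lTensor A z))) := by
  induction z using TensorProduct.induction_on with
  | zero => simp
  | add x y hx hy => simp only [map_add, TensorProduct.add_tmul, hx, hy]
  | tmul a y =>
    have h : ∀ t : A ⊗[k] Y, assoc k A A Y (D.Lequiv.toLinearMap.rTensor Y
        ((assoc k A A Y).symm (a ⊗ₜ t))) = assoc k A A Y ((D.L a).rTensor Y t) := by
      intro t
      induction t using TensorProduct.induction_on with
      | zero => simp
      | add x y hx hy => simp only [map_add, TensorProduct.tmul_add, hx, hy]
      | tmul x y => simp [Lequiv_apply]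
    rw [LinearMap.lTensor_tmul, LinearMap.flip_apply, h, D.mixed_pentagon,
      TensorProduct.lift.tmul, LinearMap.flip_apply]
    induction D.S y a using TensorProduct.induction_on with
    | zero => simp
    | add x y hx hy => simp only [map_add, TensorProduct.add_tmul, hx, hy]
    | tmul x y => simp [twist_tmul_tmul]

/-- This is `aS(x₁)x₂e₁ ⊗ x₃e₂ = ae₁ ⊗ xe₂`, which expresses the antipode axiom without leaving `A ⊗
A`. -/
theorem L_mulAntipode (a x e : A) :
    D.Lequiv ((D.mulAntipode a).rTensor A (D.R x e)) = (D.m x).lTensor A (D.L a e) := by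
  have h : ∀ z : A ⊗[k] A, D.Lequiv ((D.m.flip e).lTensor A z) =
      lift ((LinearMap.lTensorHom A ∘ₗ D.m).flip ∘ₗ D.L.flip e) (D.Lequiv z) := by
    intro z
    induction z using TensorProduct.induction_on with
    | zero => simp
    | add x y hx hy => simp only [map_add, hx, hy]
    | tmul p q => simp [Lequiv_apply, D.L_mul]
  rw [← Lequiv_symm_mul, h, LinearEquiv.apply_symm_apply]
  simp

/-- Formally, `(aS(y₋₁b) ⊗ 1)ρ(y₀) = aS(b)S(y₋₂)y₋₁ ⊗ y₀ = aS(b) ⊗ y`, with `S` on the right sides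
the antipode. To make this rigorous, a third leg is added and the injective map `twist` is applied
to both sides. -/
theorem S_mulAntipode_T (hT : Function.Injective (lift D.T)) (a b : A) (y : Y) :
    lift D.S.flip ((D.mulAntipode a).rTensor Y (D.T y b)) = D.mulAntipode a b ⊗ₜ y := by
  cases subsingleton_or_nontrivial A with
  | inl h => simp [Subsingleton.elim b 0]
  | inr h =>
  obtain ⟨e, he⟩ := exists_ne (0 : A)
  refine tmul_right_cancel (k := k) e he ?_
  have key : (lift D.S.flip ∘ₗ (D.mulAntipode a).rTensor Y ∘ₗ D.T y).rTensor A =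
      ((TensorProduct.mk k A Y).flip y ∘ₗ D.mulAntipode a).rTensor A := by
    -- Replacing `b ⊗ e` by an arbitrary tensor allows it to be taken of the form `R(b, e)`, where
    -- `pentagon_T` and `L_mulAntipode` apply.
    refine LinearMap.ext fun r => D.twist_injective hT ?_
    have h1 : ∀ r : A ⊗[k] A, D.twist
        ((lift D.S.flip ∘ₗ (D.mulAntipode a).rTensor Y ∘ₗ D.T y).rTensor A r) =
        assoc k A A Y (D.Lequiv.toLinearMap.rTensor Y ((assoc k A A Y).symm
          ((D.mulAntipode a).rTensor (A ⊗[k] Y)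
            (lift ((LinearMap.lTensorHom A ∘ₗ D.T.flip).flip ∘ₗ D.T y) r)))) := by
      intro r
      induction r using TensorProduct.induction_on with
      | zero => simp
      | add x y hx hy => simp only [map_add, hx, hy]
      | tmul b e =>
        rw [LinearMap.rTensor_tmul, LinearMap.comp_apply, LinearMap.comp_apply, twist_S,
          lTensor_rTensor_comm]
        rfl
    have h2 : ∀ r : A ⊗[k] A, D.twist
        (((TensorProduct.mk k A Y).flip y ∘ₗ D.mulAntipode a).rTensor A r) =
        (D.T y).lTensor A (D.Lequiv ((D.mulAntipode a).rTensor A r)) := by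
      intro r
      induction r using TensorProduct.induction_on with
      | zero => simp
      | add x y hx hy => simp only [map_add, hx, hy]
      | tmul b e => simp [twist_tmul_tmul, Lequiv_apply]
    obtain ⟨r, rfl⟩ := D.surjective_R r
    induction r using TensorProduct.induction_on with
    | zero => simp
    | add x y hx hy => simp only [map_add, hx, hy]
    | tmul b e =>
      rw [h1, h2, TensorProduct.lift.tmul, D.pentagon_T, L_mulAntipode, rTensor_assoc,
        LinearEquiv.symm_apply_apply, ← LinearMap.rTensor_comp_apply,
        ← LinearMap.rTensor_comp_apply]
      have h3 : D.Lequiv.toLinearMap ∘ₗ (D.mulAntipode a).rTensor A ∘ₗ D.R.flip e =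
          (LinearMap.lTensorHom A ∘ₗ D.m).flip (D.L a e) :=
        LinearMap.ext fun x => D.L_mulAntipode a x e
      rw [LinearMap.comp_assoc, h3]
      generalize D.L a e = l
      induction l using TensorProduct.induction_on with
      | zero => simp
      | add x y hx hy =>
        simp only [map_add, ← hx, ← hy, LinearMap.rTensor_add, LinearMap.add_apply]
      | tmul p q =>
        simp only [LinearMap.lTensor_tmul, D.T_mul]
        generalize D.T y b = t
        induction t using TensorProduct.induction_on with
        | zero => simp
        | add x y hx hy => simp only [map_add, TensorProduct.tmul_add, hx, hy]
        | tmul x y => simp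
  exact LinearMap.congr_fun key (b ⊗ₜ e)

/-- The elements `aS(b) ⊗ y` are values by `S_mulAntipode_T`, and they span `A ⊗ Y`. -/
theorem surjective_S (hT : Function.Injective (lift D.T)) :
    Function.Surjective (lift D.S.flip) := by
  intro z
  induction z using TensorProduct.induction_on with
  | zero => exact ⟨0, map_zero _⟩
  | add x y hx hy =>
    obtain ⟨u, rfl⟩ := hx
    obtain ⟨v, rfl⟩ := hy
    exact ⟨u + v, map_add _ _ _⟩
  | tmul a y =>
    cases subsingleton_or_nontrivial A with
    | inl h => exact ⟨0, by rw [Subsingleton.elim a 0, TensorProduct.zero_tmul, map_zero]⟩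
    | inr h =>
    obtain ⟨r, hr⟩ := D.lift_mulAntipode_surjective a
    rw [← hr]
    clear hr
    induction r using TensorProduct.induction_on with
    | zero => exact ⟨0, by simp⟩
    | add x y hx hy =>
      obtain ⟨u, hu⟩ := hx
      obtain ⟨v, hv⟩ := hy
      exact ⟨u + v, by rw [map_add, hu, hv, map_add, TensorProduct.add_tmul]⟩
    | tmul a b => exact ⟨_, D.S_mulAntipode_T hT a b y⟩

end CoactionOperators

end
end MultHopf

namespace MultHopf
noncomputable section
open TensorProduct (lift assoc)

/-! ### Calculus in multiplier algebras and extension of homomorphisms -/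

section MultiplierCalculus

variable {k : Type*} [Field k]
variable {B : Type*} [NonUnitalRing B] [Module k B] [IsScalarTower k B B] [SMulCommClass k B B]
variable {C : Type*} [NonUnitalRing C] [Module k C] [IsScalarTower k C C] [SMulCommClass k C C]

@[simp] theorem lmul_mul (m n : Multiplier k B) (b : B) : lmul (m * n) b = lmul m (lmul n b) := rfl

@[simp] theorem rmul_mul (m n : Multiplier k B) (b : B) : rmul (m * n) b = rmul n (rmul m b) := rfl

@[simp] theorem lmul_incl (a b : B) : lmul (incl k B a) b = a * b := rfl

@[simp] theorem rmul_incl (a b : B) : rmul (incl k B a) b = b * a := rfl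

theorem lmul_tens (m : Multiplier k B) (n : Multiplier k C) :
    lmul (tens m n) = TensorProduct.map (lmul m) (lmul n) := rfl

theorem rmul_tens (m : Multiplier k B) (n : Multiplier k C) :
    rmul (tens m n) = TensorProduct.map (rmul m) (rmul n) := rfl

theorem lmul_mul_assoc (m : Multiplier k B) (hB : IsNondegenerate B) (a b : B) :
    lmul m (a * b) = lmul m a * b := by
  rw [← sub_eq_zero]
  refine hB.2 _ fun c => ?_
  rw [mul_sub, sub_eq_zero, mul_lmul, ← mul_assoc, ← mul_assoc, mul_lmul]

theorem rmul_mul_assoc (m : Multiplier k B) (hB : IsNondegenerate B) (a b : B) :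
    rmul m (a * b) = a * rmul m b := by
  rw [← sub_eq_zero]
  refine hB.1 _ fun c => ?_
  rw [sub_mul, sub_eq_zero, ← mul_lmul, mul_assoc, mul_assoc, mul_lmul]

theorem mul_incl (hB : IsNondegenerate B) (m : Multiplier k B) (b : B) :
    m * incl k B b = incl k B (lmul m b) := by
  apply multiplier_ext <;> intro c
  · simp [lmul_mul_assoc m hB]
  · simp [mul_lmul]

theorem incl_mul (hB : IsNondegenerate B) (m : Multiplier k B) (b : B) :
    incl k B b * m = incl k B (rmul m b) := by
  apply multiplier_ext <;> intro c
  · simp [mul_lmul]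
  · simp [rmul_mul_assoc m hB]

theorem incl_injective (hB : IsNondegenerate B) : Function.Injective (incl k B) := by
  rw [injective_iff_map_eq_zero]
  intro a ha
  refine hB.1 a fun b => ?_
  rw [← lmul_incl (k := k), ha]
  rfl

/-- By `mul_lmul` and nondegeneracy, either half of a multiplier determines the other. -/
theorem ext_lmul (hB : IsNondegenerate B) {m n : Multiplier k B}
    (h : ∀ b, lmul m b = lmul n b) : m = n := by
  refine multiplier_ext h fun b => ?_
  rw [← sub_eq_zero]
  refine hB.1 _ fun c => ?_
  rw [sub_mul, ← mul_lmul, ← mul_lmul, h, sub_self]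

theorem ext_rmul (hB : IsNondegenerate B) {m n : Multiplier k B}
    (h : ∀ b, rmul m b = rmul n b) : m = n := by
  refine multiplier_ext (fun b => ?_) h
  rw [← sub_eq_zero]
  refine hB.2 _ fun c => ?_
  rw [mul_sub, mul_lmul, mul_lmul, h, sub_self]

theorem tens_mul_tens (m m' : Multiplier k B) (n n' : Multiplier k C) :
    tens m n * tens m' n' = tens (m * m') (n * n') := by
  apply multiplier_ext <;> intro c
  · exact (LinearMap.congr_fun (TensorProduct.map_comp _ _ _ _) c).symm
  · exact (LinearMap.congr_fun (TensorProduct.map_comp _ _ _ _) c).symm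

theorem incl_tmul (b : B) (c : C) :
    incl k (B ⊗[k] C) (b ⊗ₜ c) = tens (incl k B b) (incl k C c) := by
  apply multiplier_ext <;> intro x
  · refine LinearMap.congr_fun (f := lmul (incl k (B ⊗[k] C) (b ⊗ₜ c)))
      (g := lmul (tens (incl k B b) (incl k C c))) ?_ x
    ext x y
    simp [lmul_tens, Algebra.TensorProduct.tmul_mul_tmul]
  · refine LinearMap.congr_fun (f := rmul (incl k (B ⊗[k] C) (b ⊗ₜ c)))
      (g := rmul (tens (incl k B b) (incl k C c))) ?_ x
    ext x y
    simp [rmul_tens, Algebra.TensorProduct.tmul_mul_tmul]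

theorem lmul_tens_left (b : B) : lmul (tens (incl k B b) (1 : Multiplier k C)) =
    (LinearMap.mul k B b).rTensor C := rfl

theorem lmul_tens_right (n : Multiplier k C) : lmul (tens (1 : Multiplier k B) n) =
    (lmul n).lTensor B := rfl

theorem rmul_tens_left (b : B) : rmul (tens (incl k B b) (1 : Multiplier k C)) =
    ((LinearMap.mul k B).flip b).rTensor C := rfl

theorem rmul_tens_right (n : Multiplier k C) : rmul (tens (1 : Multiplier k B) n) =
    (rmul n).lTensor B := rfl

theorem rmul_incl_eq (b : B) : rmul (incl k B b) = (LinearMap.mul k B).flip b := rfl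

theorem lmul_incl_eq (b : B) : lmul (incl k B b) = LinearMap.mul k B b := rfl

theorem IsNondegenerate.tensorProduct (hB : IsNondegenerate B) (hC : IsNondegenerate C) :
    IsNondegenerate (B ⊗[k] C) := by
  constructor
  · intro z hz
    refine lTensor_jointly_injective (LinearMap.mul k C).flip (fun c hc => hC.1 c hc) z
      fun c => ?_
    refine rTensor_jointly_injective (LinearMap.mul k B).flip (fun b hb => hB.1 b hb) _
      fun b => ?_
    have h := hz (b ⊗ₜ c)
    rw [← rmul_incl (k := k), incl_tmul, rmul_tens, ← LinearMap.rTensor_comp_lTensor] at h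
    exact h
  · intro z hz
    refine lTensor_jointly_injective (LinearMap.mul k C) (fun c hc => hC.2 c hc) z
      fun c => ?_
    refine rTensor_jointly_injective (LinearMap.mul k B) (fun b hb => hB.2 b hb) _
      fun b => ?_
    have h := hz (b ⊗ₜ c)
    rw [← lmul_incl (k := k), incl_tmul, lmul_tens, ← LinearMap.rTensor_comp_lTensor] at h
    exact h

/-- `lmul` as a linear map. -/
def lmulHom : Multiplier k B →ₗ[k] B →ₗ[k] B where
  toFun := lmul
  map_add' _ _ := rfl
  map_smul' _ _ := rfl

/-- `rmul` as a linear map. -/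
def rmulHom : Multiplier k B →ₗ[k] B →ₗ[k] B where
  toFun := rmul
  map_add' _ _ := rfl
  map_smul' _ _ := rfl

@[simp] theorem lmulHom_apply (m : Multiplier k B) : lmulHom m = lmul m := rfl

@[simp] theorem rmulHom_apply (m : Multiplier k B) : rmulHom m = rmul m := rfl

theorem exists_factor {U V W : Type*} [AddCommGroup U] [Module k U] [AddCommGroup V] [Module k V]
    [AddCommGroup W] [Module k W] (F : U →ₗ[k] V) (G : U →ₗ[k] W) (hF : Function.Surjective F)
    (h : ∀ z z', F z = F z' → G z = G z') : ∃ L : V →ₗ[k] W, ∀ z, L (F z) = G z := by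
  obtain ⟨g, hg⟩ := F.exists_rightInverse_of_surjective (LinearMap.range_eq_top.2 hF)
  exact ⟨G ∘ₗ g, fun z => h _ _ (LinearMap.congr_fun hg (F z))⟩

/-- The extension of a nondegenerate homomorphism exists. -/
theorem exists_extension (hC : IsNondegenerate C) (φ : B →ₗ[k] Multiplier k C)
    (hφ : ∀ a b, φ (a * b) = φ a * φ b)
    (hl : Function.Surjective (lift (lmulHom ∘ₗ φ)))
    (hr : Function.Surjective (lift (rmulHom ∘ₗ φ))) (m : Multiplier k B) :
    ∃ n : Multiplier k C, ∀ b, n * φ b = φ (lmul m b) ∧ φ b * n = φ (rmul m b) := by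
  -- Both sides are `c'φ(b'mb)c`, with `m` absorbed to the right or to the left.
  have key : ∀ w z : B ⊗[k] C, lift (rmulHom ∘ₗ φ) w * lift (lmulHom ∘ₗ φ ∘ₗ lmul m) z =
      lift (rmulHom ∘ₗ φ ∘ₗ rmul m) w * lift (lmulHom ∘ₗ φ) z := by
    intro w z
    induction w using TensorProduct.induction_on with
    | zero => simp
    | add x y hx hy => simp only [map_add, add_mul, hx, hy]
    | tmul b' c' =>
      induction z using TensorProduct.induction_on with
      | zero => simp
      | add x y hx hy => simp only [map_add, mul_add, hx, hy]
      | tmul b c =>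
        simp only [TensorProduct.lift.tmul, LinearMap.comp_apply, lmulHom_apply, rmulHom_apply,
          ← mul_lmul]
        rw [← lmul_mul, ← lmul_mul, ← hφ, ← hφ, mul_lmul m]
  -- The rule `φ(b)c ↦ φ(mb)c` is well defined: by `key`, the product of its value with any
  -- `c'φ(b')` depends only on `φ(b)c`, and such elements span `C`.
  obtain ⟨L, hL⟩ := exists_factor _ (lift (lmulHom ∘ₗ φ ∘ₗ lmul m)) hl fun z z' h => by
    rw [← sub_eq_zero]
    refine hC.2 _ fun a => ?_
    obtain ⟨w, rfl⟩ := hr a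
    rw [mul_sub, key, key, h, sub_self]
  obtain ⟨R, hR⟩ := exists_factor _ (lift (rmulHom ∘ₗ φ ∘ₗ rmul m)) hr fun z z' h => by
    rw [← sub_eq_zero]
    refine hC.1 _ fun a => ?_
    obtain ⟨w, rfl⟩ := hl a
    rw [sub_mul, ← key, ← key, h, sub_self]
  refine ⟨mkMultiplier L R fun a b => ?_, fun b => ⟨ext_lmul hC fun c => ?_,
    ext_rmul hC fun c => ?_⟩⟩
  · obtain ⟨w, rfl⟩ := hr a
    obtain ⟨z, rfl⟩ := hl b
    rw [hL, hR, key]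
  · exact hL (b ⊗ₜ c)
  · exact hR (b ⊗ₜ c)

theorem extend_spec {φ : B →ₗ[k] Multiplier k C} {m : Multiplier k B}
    (h : ∃ n : Multiplier k C, ∀ b, n * φ b = φ (lmul m b) ∧ φ b * n = φ (rmul m b)) (b : B) :
    extend φ m * φ b = φ (lmul m b) ∧ φ b * extend φ m = φ (rmul m b) := by
  have : extend φ m = h.choose := dif_pos h
  rw [this]
  exact h.choose_spec b

end MultiplierCalculus

end
end MultHopf

namespace MultHopf
noncomputable section
open TensorProduct (lift assoc)

/-! ### Multiplier Hopf algebras: counit and covered comultiplications -/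

section Hopf

variable {k : Type*} [Field k]
variable {A : Type*} [NonUnitalRing A] [Module k A] [IsScalarTower k A A] [SMulCommClass k A A]
variable {Δ : A →ₗ[k] Multiplier k (A ⊗[k] A)}

theorem lift_mem {U V W : Type*} [AddCommGroup U] [Module k U] [AddCommGroup V] [Module k V]
    [AddCommGroup W] [Module k W] (f : U →ₗ[k] V →ₗ[k] W) (S : Submodule k W)
    (h : ∀ u v, f u v ∈ S) (z : U ⊗[k] V) : lift f z ∈ S := by
  induction z using TensorProduct.induction_on with
  | zero => simp
  | add x y hx hy => rw [map_add]; exact S.add_mem hx hy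
  | tmul u v => exact h u v

namespace IsMultiplierHopf

theorem nondegenerate_tensor (h : IsMultiplierHopf Δ) : IsNondegenerate (A ⊗[k] A) :=
  h.nondegenerate.tensorProduct h.nondegenerate

theorem incl_comulR2 (h : IsMultiplierHopf Δ) (a b : A) :
    incl k (A ⊗[k] A) (comulR2 Δ (a ⊗ₜ b)) = Δ a * tens 1 (incl k A b) :=
  incl_descend _ (lift_mem _ _ h.mem_right) (a ⊗ₜ b)

theorem incl_comulL1 (h : IsMultiplierHopf Δ) (a b : A) :
    incl k (A ⊗[k] A) (comulL1 Δ (a ⊗ₜ b)) = tens (incl k A a) 1 * Δ b :=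
  incl_descend _ (lift_mem _ _ h.mem_left) (a ⊗ₜ b)

theorem comulL1_comulR2 (h : IsMultiplierHopf Δ) (a b c : A) :
    ((LinearMap.mul k A).flip c).lTensor A (comulL1 Δ (a ⊗ₜ b)) =
      (LinearMap.mul k A a).rTensor A (comulR2 Δ (b ⊗ₜ c)) := by
  apply incl_injective (k := k) h.nondegenerate_tensor
  rw [← rmul_incl_eq, ← rmul_tens_right, ← incl_mul h.nondegenerate_tensor, h.incl_comulL1,
    ← lmul_tens_left, ← mul_incl h.nondegenerate_tensor, h.incl_comulR2, mul_assoc]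

theorem comulR2_mul (h : IsMultiplierHopf Δ) (a : A) (z : A ⊗[k] A) :
    comulR2 Δ ((LinearMap.mul k A a).rTensor A z) = lmul (Δ a) (comulR2 Δ z) := by
  induction z using TensorProduct.induction_on with
  | zero => simp
  | add x y hx hy => simp only [map_add, hx, hy]
  | tmul b c =>
    apply incl_injective (k := k) h.nondegenerate_tensor
    rw [← mul_incl h.nondegenerate_tensor, h.incl_comulR2, LinearMap.rTensor_tmul,
      h.incl_comulR2, LinearMap.mul_apply', h.map_mul, mul_assoc]

theorem assoc_comulL1_comulR2 (h : IsMultiplierHopf Δ) (a : A) (z : A ⊗[k] A) :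
    assoc k A A A ((comulL1 Δ ∘ₗ TensorProduct.mk k A A a).rTensor A (comulR2 Δ z)) =
      (comulR2 Δ).lTensor A (assoc k A A A
        ((comulL1 Δ ∘ₗ TensorProduct.mk k A A a).rTensor A z)) := by
  induction z using TensorProduct.induction_on with
  | zero => simp
  | add x y hx hy => simp only [map_add, hx, hy]
  | tmul b c =>
    rw [h.coassoc, LinearMap.rTensor_tmul, LinearMap.comp_apply, TensorProduct.mk_apply]
    induction comulL1 Δ (a ⊗ₜ b) using TensorProduct.induction_on with
    | zero => simp
    | add x y hx hy => simp only [map_add, TensorProduct.add_tmul, hx, hy]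
    | tmul x y => simp

/-- The counit of a multiplier Hopf algebra exists: `ε(a) b = m(R⁻¹(a ⊗ b))` with
`R(a ⊗ b) = Δ(a)(1 ⊗ b)`. -/
theorem exists_isCounit (h : IsMultiplierHopf Δ) : ∃ ε : A →ₗ[k] k, IsCounit Δ ε := by
  cases subsingleton_or_nontrivial A with
  | inl _ =>
    exact ⟨0, fun a b => by simp, fun a b => Subsingleton.elim _ _,
      fun a b => Subsingleton.elim _ _⟩
  | inr _ =>
  let R := LinearEquiv.ofBijective (comulR2 Δ) h.bijective_right
  let L := LinearEquiv.ofBijective (comulL1 Δ) h.bijective_left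
  have hR : ∀ z, R z = comulR2 Δ z := fun _ => rfl
  have hL : ∀ z, L z = comulL1 Δ z := fun _ => rfl
  let μ : A ⊗[k] A →ₗ[k] A := LinearMap.mul' k A
  -- Coassociativity makes `R` on the last two legs compatible with `(a ⊗ 1)Δ(·)`; undoing `R` and
  -- multiplying leaves `(a ⊗ 1)Δ(p)(1 ⊗ q)`, that is, `a` times the first leg of `R(p ⊗ q)`.
  have h1 : ∀ a b c, (μ ∘ₗ R.symm.toLinearMap).lTensor A
      (assoc k A A A (comulL1 Δ (a ⊗ₜ b) ⊗ₜ c)) = (a * b) ⊗ₜ c := by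
    intro a b c
    have h2 := h.assoc_comulL1_comulR2 a (R.symm (b ⊗ₜ c))
    rw [← hR, LinearEquiv.apply_symm_apply] at h2
    have h3 := congrArg ((μ ∘ₗ R.symm.toLinearMap).lTensor A) h2
    rw [← LinearMap.lTensor_comp_apply, LinearMap.comp_assoc] at h3
    have h4 : R.symm.toLinearMap ∘ₗ comulR2 Δ = LinearMap.id :=
      LinearMap.ext R.symm_apply_apply
    rw [h4, LinearMap.comp_id] at h3
    refine h3.trans ?_
    have h5 : ∀ z : A ⊗[k] A, μ.lTensor A (assoc k A A A
        ((comulL1 Δ ∘ₗ TensorProduct.mk k A A a).rTensor A z)) =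
        (LinearMap.mul k A a).rTensor A (comulR2 Δ z) := by
      intro z
      induction z using TensorProduct.induction_on with
      | zero => simp
      | add x y hx hy => simp only [map_add, hx, hy]
      | tmul p q =>
        rw [← h.comulL1_comulR2, LinearMap.rTensor_tmul, LinearMap.comp_apply,
          TensorProduct.mk_apply]
        induction comulL1 Δ (a ⊗ₜ p) using TensorProduct.induction_on with
        | zero => simp
        | add x y hx hy => simp only [map_add, TensorProduct.add_tmul, hx, hy]
        | tmul x y => simp [μ]
    rw [h5, ← hR, LinearEquiv.apply_symm_apply]
    simp
  -- Only the left side can involve `c` in its second leg through `u`, and only the right side can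
  -- involve `d` through `u`. Hence `mR⁻¹(u ⊗ c)` is a scalar multiple of `c`, with scalar `ε(u)`,
  -- and the same scalar governs `mL⁻¹(d ⊗ u)`.
  have h2 : ∀ d u c : A, d ⊗ₜ μ (R.symm (u ⊗ₜ c)) = μ (L.symm (d ⊗ₜ u)) ⊗ₜ[k] c := by
    intro d u c
    have h3 : ∀ z : A ⊗[k] A, (μ ∘ₗ R.symm.toLinearMap).lTensor A
        (assoc k A A A (L z ⊗ₜ c)) = μ z ⊗ₜ c := by
      intro z
      induction z using TensorProduct.induction_on with
      | zero => simp
      | add x y hx hy => simp only [map_add, TensorProduct.add_tmul, hx, hy]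
      | tmul a b => exact h1 a b c
    have h4 := h3 (L.symm (d ⊗ₜ u))
    rw [LinearEquiv.apply_symm_apply] at h4
    simpa using h4
  obtain ⟨d, hd⟩ := exists_ne (0 : A)
  obtain ⟨φ, hφ⟩ := Module.Projective.exists_dual_eq_one k hd
  let ε : A →ₗ[k] k := φ ∘ₗ μ ∘ₗ L.symm.toLinearMap ∘ₗ TensorProduct.mk k A A d
  have hεR : ∀ u c, μ (R.symm (u ⊗ₜ c)) = ε u • c := by
    intro u c
    have h3 := congrArg (evalLeft φ) (h2 d u c)
    rw [evalLeft_tmul, evalLeft_tmul, hφ, one_smul] at h3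
    exact h3
  have hεL : ∀ d' u, μ (L.symm (d' ⊗ₜ u)) = ε u • d' := by
    intro d' u
    refine tmul_right_cancel (k := k) d hd ?_
    rw [← h2, hεR, TensorProduct.tmul_smul, TensorProduct.smul_tmul']
  have hR' : ∀ z, evalLeft ε (R z) = μ z := by
    intro z
    obtain ⟨w, rfl⟩ := R.symm.surjective z
    rw [LinearEquiv.apply_symm_apply]
    induction w using TensorProduct.induction_on with
    | zero => simp
    | add x y hx hy => simp only [map_add, hx, hy]
    | tmul u c => rw [hεR, evalLeft_tmul]
  have hL' : ∀ z, evalRight ε (L z) = μ z := by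
    intro z
    obtain ⟨w, rfl⟩ := L.symm.surjective z
    rw [LinearEquiv.apply_symm_apply]
    induction w using TensorProduct.induction_on with
    | zero => simp
    | add x y hx hy => simp only [map_add, hx, hy]
    | tmul u c => rw [hεL, evalRight_tmul]
  refine ⟨ε, fun u p => ?_, fun a b => hR' (a ⊗ₜ b), fun a b => hL' (a ⊗ₜ b)⟩
  -- Multiplicativity: `(ε ⊗ ι)(Δ(a)w) = a(ε ⊗ ι)(w)`. Taking `w = p ⊗ q` and writing `Δ(a)(p ⊗ q) =
  -- R(a ⊗ q)(p ⊗ 1)` shows that right multiplication by `p` on the first leg scales `ε ⊗ ι` by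
  -- `ε(p)`.
  have h3 : ∀ a w, evalLeft ε (lmul (Δ a) w) = a * evalLeft ε w := by
    intro a w
    obtain ⟨z, rfl⟩ := R.surjective w
    rw [hR', hR, ← h.comulR2_mul, ← hR, hR']
    induction z using TensorProduct.induction_on with
    | zero => simp
    | add x y hx hy => simp only [map_add, mul_add, hx, hy]
    | tmul b c => simp [μ, mul_assoc]
  have h4 : ∀ t : A ⊗[k] A, evalLeft ε (((LinearMap.mul k A).flip p).rTensor A t) =
      ε p • evalLeft ε t := by
    intro t
    obtain ⟨z, rfl⟩ := R.surjective t
    induction z using TensorProduct.induction_on with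
    | zero => simp
    | add x y hx hy => simp only [map_add, smul_add, hx, hy]
    | tmul a q =>
      have h5 : ((LinearMap.mul k A).flip p).rTensor A (R (a ⊗ₜ q)) = lmul (Δ a) (p ⊗ₜ q) := by
        apply incl_injective (k := k) h.nondegenerate_tensor
        rw [← rmul_tens_left, ← incl_mul h.nondegenerate_tensor, hR, h.incl_comulR2,
          ← mul_incl h.nondegenerate_tensor, incl_tmul, mul_assoc, tens_mul_tens, one_mul, mul_one]
      rw [h5, h3, hR']
      simp [μ, mul_smul_comm]
  have h5 := congrArg φ (h4 (u ⊗ₜ d))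
  simpa [hφ, mul_comm] using h5

end IsMultiplierHopf

theorem isCounit_counit (h : IsMultiplierHopf Δ) : IsCounit Δ (counit Δ) := by
  have : counit Δ = h.exists_isCounit.choose := dif_pos h.exists_isCounit
  rw [this]
  exact h.exists_isCounit.choose_spec

theorem comm_comm {V : Type*} [AddCommGroup V] [Module k V] (x : V ⊗[k] V) :
    TensorProduct.comm k V V (TensorProduct.comm k V V x) = x :=
  (TensorProduct.comm k V V).symm_apply_apply x

section Flip

variable {B : Type*} [NonUnitalRing B] [Module k B] [IsScalarTower k B B] [SMulCommClass k B B]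

theorem lmul_flipMultiplier (m : Multiplier k (B ⊗[k] B)) (x : B ⊗[k] B) :
    lmul (flipMultiplier m) x =
      TensorProduct.comm k B B (lmul m (TensorProduct.comm k B B x)) := rfl

theorem rmul_flipMultiplier (m : Multiplier k (B ⊗[k] B)) (x : B ⊗[k] B) :
    rmul (flipMultiplier m) x =
      TensorProduct.comm k B B (rmul m (TensorProduct.comm k B B x)) := rfl

theorem flipMultiplier_flipMultiplier (m : Multiplier k (B ⊗[k] B)) :
    flipMultiplier (flipMultiplier m) = m := by
  apply multiplier_ext <;> intro x
  · simp only [lmul_flipMultiplier, comm_comm]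
  · simp only [rmul_flipMultiplier, comm_comm]

theorem flipMultiplier_mul (m n : Multiplier k (B ⊗[k] B)) :
    flipMultiplier (m * n) = flipMultiplier m * flipMultiplier n := by
  apply multiplier_ext <;> intro x
  · simp only [lmul_mul, lmul_flipMultiplier, comm_comm]
  · simp only [rmul_mul, rmul_flipMultiplier, comm_comm]

theorem flipMultiplier_tens (m n : Multiplier k B) :
    flipMultiplier (tens m n) = tens n m := by
  apply multiplier_ext <;> intro x
  · rw [lmul_flipMultiplier]
    induction x using TensorProduct.induction_on with
    | zero => simp
    | add x y hx hy => simp only [map_add, hx, hy]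
    | tmul u v => simp [lmul_tens]
  · rw [rmul_flipMultiplier]
    induction x using TensorProduct.induction_on with
    | zero => simp
    | add x y hx hy => simp only [map_add, hx, hy]
    | tmul u v => simp [rmul_tens]

theorem flipMultiplier_incl (x : B ⊗[k] B) :
    flipMultiplier (incl k (B ⊗[k] B) x) =
      incl k (B ⊗[k] B) (TensorProduct.comm k B B x) := by
  induction x using TensorProduct.induction_on with
  | zero => simp
  | add x y hx hy => simp only [map_add, hx, hy]
  | tmul u v => rw [incl_tmul, flipMultiplier_tens, TensorProduct.comm_tmul, incl_tmul]

end Flip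

namespace IsRegularMultiplierHopf

/-- The products covered on the other leg are flips of those of the co-opposite comultiplication;
this is where regularity enters. -/
theorem mem_R1 (h : IsRegularMultiplierHopf Δ) (a b : A) :
    Δ a * tens (incl k A b) 1 ∈ LinearMap.range (incl k (A ⊗[k] A)) := by
  obtain ⟨w, hw⟩ := h.isMultiplierHopf_cop.mem_right a b
  refine ⟨TensorProduct.comm k A A w, ?_⟩
  rw [← flipMultiplier_incl, hw, flipMultiplier_mul, LinearMap.comp_apply,
    flipMultiplier_flipMultiplier, flipMultiplier_tens]

theorem mem_L2 (h : IsRegularMultiplierHopf Δ) (a b : A) :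
    tens 1 (incl k A a) * Δ b ∈ LinearMap.range (incl k (A ⊗[k] A)) := by
  obtain ⟨w, hw⟩ := h.isMultiplierHopf_cop.mem_left a b
  refine ⟨TensorProduct.comm k A A w, ?_⟩
  rw [← flipMultiplier_incl, hw, flipMultiplier_mul, LinearMap.comp_apply,
    flipMultiplier_flipMultiplier, flipMultiplier_tens]

theorem incl_comulR1 (h : IsRegularMultiplierHopf Δ) (a b : A) :
    incl k (A ⊗[k] A) (comulR1 Δ (a ⊗ₜ b)) = Δ a * tens (incl k A b) 1 :=
  incl_descend _ (lift_mem _ _ h.mem_R1) (a ⊗ₜ b)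

theorem incl_comulL2 (h : IsRegularMultiplierHopf Δ) (a b : A) :
    incl k (A ⊗[k] A) (comulL2 Δ (a ⊗ₜ b)) = tens 1 (incl k A a) * Δ b :=
  incl_descend _ (lift_mem _ _ h.mem_L2) (a ⊗ₜ b)

theorem nondegenerate (h : IsRegularMultiplierHopf Δ) : IsNondegenerate A :=
  h.isMultiplierHopf.nondegenerate

theorem nondegenerate_tensor (h : IsRegularMultiplierHopf Δ) : IsNondegenerate (A ⊗[k] A) :=
  h.isMultiplierHopf.nondegenerate_tensor

theorem comulR2_cop (h : IsRegularMultiplierHopf Δ) (z : A ⊗[k] A) :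
    comulR2 (flipMultiplier ∘ₗ Δ) z = TensorProduct.comm k A A (comulR1 Δ z) := by
  induction z using TensorProduct.induction_on with
  | zero => simp
  | add x y hx hy => simp only [map_add, hx, hy]
  | tmul a b =>
    apply incl_injective (k := k) h.nondegenerate_tensor
    rw [h.isMultiplierHopf_cop.incl_comulR2, ← flipMultiplier_incl, h.incl_comulR1,
      flipMultiplier_mul, flipMultiplier_tens]
    rfl

theorem comulL1_cop (h : IsRegularMultiplierHopf Δ) (z : A ⊗[k] A) :
    comulL1 (flipMultiplier ∘ₗ Δ) z = TensorProduct.comm k A A (comulL2 Δ z) := by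
  induction z using TensorProduct.induction_on with
  | zero => simp
  | add x y hx hy => simp only [map_add, hx, hy]
  | tmul a b =>
    apply incl_injective (k := k) h.nondegenerate_tensor
    rw [h.isMultiplierHopf_cop.incl_comulL1, ← flipMultiplier_incl, h.incl_comulL2,
      flipMultiplier_mul, flipMultiplier_tens]
    rfl

theorem bijective_comulR1 (h : IsRegularMultiplierHopf Δ) : Function.Bijective (comulR1 Δ) := by
  have h1 : ⇑(comulR1 Δ) = TensorProduct.comm k A A ∘ comulR2 (flipMultiplier ∘ₗ Δ) := by
    ext z; simp only [Function.comp, h.comulR2_cop, comm_comm]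
  rw [h1]
  exact (LinearEquiv.bijective _).comp h.isMultiplierHopf_cop.bijective_right

theorem bijective_comulL2 (h : IsRegularMultiplierHopf Δ) : Function.Bijective (comulL2 Δ) := by
  have h1 : ⇑(comulL2 Δ) = TensorProduct.comm k A A ∘ comulL1 (flipMultiplier ∘ₗ Δ) := by
    ext z; simp only [Function.comp, h.comulL1_cop, comm_comm]
  rw [h1]
  exact (LinearEquiv.bijective _).comp h.isMultiplierHopf_cop.bijective_left

theorem coassoc_op (h : IsRegularMultiplierHopf Δ) (a b c : A) :
    assoc k A A A ((comulR1 Δ ∘ₗ (TensorProduct.mk k A A).flip a).rTensor A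
      (comulL2 Δ (c ⊗ₜ b))) =
    (comulL2 Δ ∘ₗ TensorProduct.mk k A A c).lTensor A (comulR1 Δ (b ⊗ₜ a)) := by
  -- `r` reverses the order of the three legs; it carries the coassociativity of `Δᶜᵒᵖ` to the
  -- desired identity.
  let r : A ⊗[k] (A ⊗[k] A) ≃ₗ[k] A ⊗[k] (A ⊗[k] A) :=
    (TensorProduct.comm k A (A ⊗[k] A)).trans ((TensorProduct.congr (TensorProduct.comm k A A)
      (LinearEquiv.refl k A)).trans (assoc k A A A))
  have h0 : ∀ x y z : A, r (x ⊗ₜ (y ⊗ₜ z)) = z ⊗ₜ (y ⊗ₜ x) := fun x y z => by simp [r]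
  have hc := h.isMultiplierHopf_cop.coassoc c b a
  have e1 : ∀ (f g : A →ₗ[k] A ⊗[k] A) (t : A ⊗[k] A),
      (∀ x, g x = TensorProduct.comm k A A (f x)) →
      assoc k A A A (g.rTensor A (TensorProduct.comm k A A t)) = r (f.lTensor A t) := by
    intro f g t hfg
    induction t using TensorProduct.induction_on with
    | zero => simp
    | add x y hx hy => simp only [map_add, hx, hy]
    | tmul x y =>
      rw [TensorProduct.comm_tmul, LinearMap.rTensor_tmul, LinearMap.lTensor_tmul, hfg]
      induction f y using TensorProduct.induction_on with
      | zero => simp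
      | add x y hx hy => simp only [map_add, TensorProduct.add_tmul, TensorProduct.tmul_add, hx, hy]
      | tmul p q => simp [h0]
  have e2 : ∀ (f g : A →ₗ[k] A ⊗[k] A) (t : A ⊗[k] A),
      (∀ x, g x = TensorProduct.comm k A A (f x)) →
      g.lTensor A (TensorProduct.comm k A A t) = r (assoc k A A A (f.rTensor A t)) := by
    intro f g t hfg
    induction t using TensorProduct.induction_on with
    | zero => simp
    | add x y hx hy => simp only [map_add, hx, hy]
    | tmul x y =>
      rw [TensorProduct.comm_tmul, LinearMap.rTensor_tmul, LinearMap.lTensor_tmul, hfg]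
      induction f x using TensorProduct.induction_on with
      | zero => simp
      | add x y hx hy => simp only [map_add, TensorProduct.add_tmul, TensorProduct.tmul_add, hx, hy]
      | tmul p q => simp [h0]
  rw [h.comulR2_cop, h.comulL1_cop,
    e1 (comulL2 Δ ∘ₗ TensorProduct.mk k A A c) _ _ fun x => h.comulL1_cop _,
    e2 (comulR1 Δ ∘ₗ (TensorProduct.mk k A A).flip a) _ _ fun x => h.comulR2_cop _] at hc
  exact (r.injective hc).symm

theorem comulL2_comulR2 (h : IsRegularMultiplierHopf Δ) (c a b : A) :
    ((LinearMap.mul k A).flip b).lTensor A (comulL2 Δ (c ⊗ₜ a)) =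
      (LinearMap.mul k A c).lTensor A (comulR2 Δ (a ⊗ₜ b)) := by
  apply incl_injective (k := k) h.nondegenerate_tensor
  rw [← rmul_incl_eq, ← rmul_tens_right, ← incl_mul h.nondegenerate_tensor, h.incl_comulL2,
    ← lmul_incl_eq, ← lmul_tens_right, ← mul_incl h.nondegenerate_tensor,
    h.isMultiplierHopf.incl_comulR2, mul_assoc]

theorem comulR1_comulR2 (h : IsRegularMultiplierHopf Δ) (a p q : A) :
    ((LinearMap.mul k A).flip q).lTensor A (comulR1 Δ (a ⊗ₜ p)) =
      ((LinearMap.mul k A).flip p).rTensor A (comulR2 Δ (a ⊗ₜ q)) := by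
  apply incl_injective (k := k) h.nondegenerate_tensor
  rw [← rmul_incl_eq, ← rmul_tens_right, ← incl_mul h.nondegenerate_tensor, h.incl_comulR1,
    ← rmul_tens_left, ← incl_mul h.nondegenerate_tensor,
    h.isMultiplierHopf.incl_comulR2, mul_assoc, mul_assoc, tens_mul_tens, tens_mul_tens]
  simp

theorem comulL2_comulR1 (h : IsRegularMultiplierHopf Δ) (c b a : A) :
    (LinearMap.mul k A c).lTensor A (comulR1 Δ (b ⊗ₜ a)) =
      ((LinearMap.mul k A).flip a).rTensor A (comulL2 Δ (c ⊗ₜ b)) := by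
  apply incl_injective (k := k) h.nondegenerate_tensor
  rw [← lmul_incl_eq, ← lmul_tens_right, ← mul_incl h.nondegenerate_tensor, h.incl_comulR1,
    ← rmul_tens_left, ← incl_mul h.nondegenerate_tensor, h.incl_comulL2, mul_assoc]

theorem comulL1_mul (h : IsRegularMultiplierHopf Δ) (a b c : A) :
    comulL1 Δ (a ⊗ₜ (b * c)) = lift ((LinearMap.lTensorHom A ∘ₗ LinearMap.mul k A).flip ∘ₗ
      (comulL1 Δ ∘ₗ (TensorProduct.mk k A A).flip c)) (comulL1 Δ (a ⊗ₜ b)) := by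
  have key : ∀ t : A ⊗[k] A, incl k (A ⊗[k] A) t * Δ c = incl k (A ⊗[k] A)
      (lift ((LinearMap.lTensorHom A ∘ₗ LinearMap.mul k A).flip ∘ₗ
        (comulL1 Δ ∘ₗ (TensorProduct.mk k A A).flip c)) t) := by
    intro t
    induction t using TensorProduct.induction_on with
    | zero => simp
    | add x y hx hy => simp only [map_add, add_mul, hx, hy]
    | tmul x z =>
      -- In this order `x ⊗ 1` meets `Δ(c)` first and covers it.
      have e : tens (incl k A x) (incl k A z) =
          tens 1 (incl k A z) * tens (incl k A x) 1 := by
        rw [tens_mul_tens, one_mul, mul_one]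
      rw [incl_tmul, e, mul_assoc, ← h.isMultiplierHopf.incl_comulL1,
        mul_incl h.nondegenerate_tensor]
      rfl
  apply incl_injective (k := k) h.nondegenerate_tensor
  rw [← key, h.isMultiplierHopf.incl_comulL1, h.isMultiplierHopf.incl_comulL1,
    h.isMultiplierHopf.map_mul, mul_assoc]

theorem comulR1_mul (h : IsRegularMultiplierHopf Δ) (a b c : A) :
    comulR1 Δ ((c * b) ⊗ₜ a) =
      lift ((LinearMap.lTensorHom A ∘ₗ (LinearMap.mul k A).flip).flip ∘ₗ
        (comulR1 Δ ∘ₗ TensorProduct.mk k A A c)) (comulR1 Δ (b ⊗ₜ a)) := by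
  have key : ∀ t : A ⊗[k] A, Δ c * incl k (A ⊗[k] A) t = incl k (A ⊗[k] A)
      (lift ((LinearMap.lTensorHom A ∘ₗ (LinearMap.mul k A).flip).flip ∘ₗ
        (comulR1 Δ ∘ₗ TensorProduct.mk k A A c)) t) := by
    intro t
    induction t using TensorProduct.induction_on with
    | zero => simp
    | add x y hx hy => simp only [map_add, mul_add, hx, hy]
    | tmul x z =>
      have e : tens (incl k A x) (incl k A z) =
          tens (incl k A x) 1 * tens 1 (incl k A z) := by
        rw [tens_mul_tens, one_mul, mul_one]
      rw [incl_tmul, e, ← mul_assoc, ← h.incl_comulR1, incl_mul h.nondegenerate_tensor]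
      rfl
  apply incl_injective (k := k) h.nondegenerate_tensor
  rw [← key, h.incl_comulR1, h.incl_comulR1, h.isMultiplierHopf.map_mul, mul_assoc]

end IsRegularMultiplierHopf

section Counit

variable {ε : A →ₗ[k] k}

namespace IsCounit

theorem map_mul_right (hε : IsCounit Δ ε) (a x : A) :
    ε ((LinearMap.mul k A).flip a x) = ε a * ε x := by
  simp [hε.map_mul, mul_comm]

theorem evalLeft_comulR2 (hε : IsCounit Δ ε) (a b : A) :
    evalLeft ε (comulR2 Δ (a ⊗ₜ b)) = a * b := hε.left a b

theorem evalRight_comulL1 (hε : IsCounit Δ ε) (a b : A) :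
    evalRight ε (comulL1 Δ (a ⊗ₜ b)) = a * b := hε.right a b

theorem exists_ne_zero [Nontrivial A] (hε : IsCounit Δ ε) (hA : IsNondegenerate A) :
    ∃ a, ε a ≠ 0 := by
  by_contra! h0
  have h1 : ε = 0 := LinearMap.ext h0
  obtain ⟨a, ha⟩ := exists_ne (0 : A)
  refine ha (hA.1 a fun b => ?_)
  rw [← hε.evalLeft_comulR2, h1]
  simp [evalLeft]

/-- The counit axioms cover only two products. This and the next two identities follow by
multiplying the other leg, comparing with a known product and cancelling. -/
theorem evalLeft_comulL2 (hε : IsCounit Δ ε) (h : IsRegularMultiplierHopf Δ) (c a : A) :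
    evalLeft ε (comulL2 Δ (c ⊗ₜ a)) = c * a := by
  rw [← sub_eq_zero]
  refine h.nondegenerate.1 _ fun b => ?_
  have h1 := congrArg (evalLeft ε) (h.comulL2_comulR2 c a b)
  rw [evalLeft_lTensor, evalLeft_lTensor, hε.evalLeft_comulR2] at h1
  rw [sub_mul, sub_eq_zero, mul_assoc]
  exact h1

theorem evalLeft_comulR1 (hε : IsCounit Δ ε) (h : IsRegularMultiplierHopf Δ) (a p : A) :
    evalLeft ε (comulR1 Δ (a ⊗ₜ p)) = ε p • a := by
  rw [← sub_eq_zero]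
  refine h.nondegenerate.1 _ fun b => ?_
  have h1 := congrArg (evalLeft ε) (h.comulR1_comulR2 a p b)
  rw [evalLeft_lTensor, evalLeft_rTensor _ _ (ε p) (hε.map_mul_right p),
    hε.evalLeft_comulR2] at h1
  rw [sub_mul, sub_eq_zero, smul_mul_assoc]
  exact h1

theorem evalRight_comulR2 (hε : IsCounit Δ ε) (h : IsRegularMultiplierHopf Δ) (a q : A) :
    evalRight ε (comulR2 Δ (a ⊗ₜ q)) = ε q • a := by
  rw [← sub_eq_zero]
  refine h.nondegenerate.2 _ fun b => ?_
  have h1 := congrArg (evalRight ε) (h.isMultiplierHopf.comulL1_comulR2 b a q)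
  rw [evalRight_rTensor, evalRight_lTensor _ _ (ε q) (hε.map_mul_right q),
    hε.evalRight_comulL1] at h1
  rw [mul_sub, sub_eq_zero, mul_smul_comm]
  exact h1.symm

end IsCounit

end Counit

end Hopf
end
end MultHopf

namespace MultHopf
noncomputable section
open TensorProduct (lift assoc curry)

/-! ### Cancellation of one-leg multipliers -/

section Cancel

variable {k : Type*} [Field k]
variable {B : Type*} [NonUnitalRing B] [Module k B] [IsScalarTower k B B] [SMulCommClass k B B]
variable {C : Type*} [NonUnitalRing C] [Module k C] [IsScalarTower k C C] [SMulCommClass k C C]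

theorem mul_tens_right_cancel (hB : IsNondegenerate B) (hC : IsNondegenerate C)
    {m n : Multiplier k (B ⊗[k] C)}
    (h : ∀ u, m * tens 1 (incl k C u) = n * tens 1 (incl k C u)) : m = n := by
  refine ext_rmul (hB.tensorProduct hC) fun c => ?_
  rw [← sub_eq_zero]
  refine lTensor_jointly_injective (LinearMap.mul k C).flip (fun c hc => hC.1 c hc) _ fun u => ?_
  rw [map_sub, sub_eq_zero]
  exact congrArg (fun m => rmul m c) (h u)

theorem tens_right_mul_cancel (hB : IsNondegenerate B) (hC : IsNondegenerate C)
    {m n : Multiplier k (B ⊗[k] C)}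
    (h : ∀ u, tens 1 (incl k C u) * m = tens 1 (incl k C u) * n) : m = n := by
  refine ext_lmul (hB.tensorProduct hC) fun c => ?_
  rw [← sub_eq_zero]
  refine lTensor_jointly_injective (LinearMap.mul k C) (fun c hc => hC.2 c hc) _ fun u => ?_
  rw [map_sub, sub_eq_zero]
  exact congrArg (fun m => lmul m c) (h u)

theorem mul_tens_left_cancel (hB : IsNondegenerate B) (hC : IsNondegenerate C)
    {m n : Multiplier k (B ⊗[k] C)}
    (h : ∀ u, m * tens (incl k B u) 1 = n * tens (incl k B u) 1) : m = n := by
  refine ext_rmul (hB.tensorProduct hC) fun c => ?_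
  rw [← sub_eq_zero]
  refine rTensor_jointly_injective (LinearMap.mul k B).flip (fun c hc => hB.1 c hc) _ fun u => ?_
  rw [map_sub, sub_eq_zero]
  exact congrArg (fun m => rmul m c) (h u)

theorem tens_left_mul_cancel (hB : IsNondegenerate B) (hC : IsNondegenerate C)
    {m n : Multiplier k (B ⊗[k] C)}
    (h : ∀ u, tens (incl k B u) 1 * m = tens (incl k B u) 1 * n) : m = n := by
  refine ext_lmul (hB.tensorProduct hC) fun c => ?_
  rw [← sub_eq_zero]
  refine rTensor_jointly_injective (LinearMap.mul k B) (fun c hc => hB.2 c hc) _ fun u => ?_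
  rw [map_sub, sub_eq_zero]
  exact congrArg (fun m => lmul m c) (h u)

end Cancel

/-! ### Idempotency of the algebra and nondegeneracy of the comultiplication -/

section Idempotent

variable {k : Type*} [Field k]
variable {A : Type*} [NonUnitalRing A] [Module k A] [IsScalarTower k A A] [SMulCommClass k A A]
variable {Δ : A →ₗ[k] Multiplier k (A ⊗[k] A)}

namespace IsMultiplierHopf

/-- The product equals `(ε ⊗ ι)R`, a composite of surjections when `A` is nonzero. -/
theorem mul'_surjective (h : IsMultiplierHopf Δ) : Function.Surjective (LinearMap.mul' k A) := by
  intro a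
  cases subsingleton_or_nontrivial A with
  | inl _ => exact ⟨0, Subsingleton.elim _ _⟩
  | inr _ =>
  have hε := isCounit_counit h
  have h1 : ∀ z, evalLeft (counit Δ) (comulR2 Δ z) = LinearMap.mul' k A z := by
    intro z
    induction z using TensorProduct.induction_on with
    | zero => simp
    | add x y hx hy => simp only [map_add, hx, hy]
    | tmul a b => rw [hε.evalLeft_comulR2, LinearMap.mul'_apply]
  obtain ⟨b, hb⟩ := hε.exists_ne_zero h.nondegenerate
  obtain ⟨z, hz⟩ := h.bijective_right.2 (((counit Δ b)⁻¹ • b) ⊗ₜ a)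
  exact ⟨z, by rw [← h1, hz]; simp [hb]⟩

/-- Write the first leg as a sum of products `u'u`, and `u' ⊗ v` as a sum of `Δ(a)(1 ⊗ b)`; then
`u'u ⊗ v` is a sum of `Δ(a)(u ⊗ b)`. -/
theorem lmul_comul_surjective (h : IsMultiplierHopf Δ) :
    Function.Surjective (lift (lmulHom ∘ₗ Δ)) := by
  rw [← LinearMap.range_eq_top, eq_top_iff]
  rintro x -
  induction x using TensorProduct.induction_on with
  | zero => exact Submodule.zero_mem _
  | add x y hx hy => exact Submodule.add_mem _ hx hy
  | tmul u v =>
    obtain ⟨w, rfl⟩ := h.mul'_surjective (k := k) u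
    induction w using TensorProduct.induction_on with
    | zero => simp
    | add x y hx hy =>
      rw [map_add, TensorProduct.add_tmul]
      exact Submodule.add_mem _ hx hy
    | tmul u' u =>
      have h1 : ∀ t : A ⊗[k] A, ((LinearMap.mul k A).flip u).rTensor A t ∈
          LinearMap.range (lift (lmulHom ∘ₗ Δ)) := by
        intro t
        obtain ⟨z, rfl⟩ := h.bijective_right.2 t
        induction z using TensorProduct.induction_on with
        | zero => simp
        | add x y hx hy => simp only [map_add]; exact Submodule.add_mem _ hx hy
        | tmul a b =>
          refine ⟨a ⊗ₜ (u ⊗ₜ b), ?_⟩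
          apply incl_injective (k := k) h.nondegenerate_tensor
          rw [← rmul_tens_left, ← incl_mul h.nondegenerate_tensor, h.incl_comulR2, mul_assoc,
            tens_mul_tens, one_mul, mul_one, ← incl_tmul, mul_incl h.nondegenerate_tensor]
          rfl
      exact h1 (u' ⊗ₜ v)

theorem rmul_comul_surjective (h : IsMultiplierHopf Δ) :
    Function.Surjective (lift (rmulHom ∘ₗ Δ)) := by
  rw [← LinearMap.range_eq_top, eq_top_iff]
  rintro x -
  induction x using TensorProduct.induction_on with
  | zero => exact Submodule.zero_mem _
  | add x y hx hy => exact Submodule.add_mem _ hx hy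
  | tmul u v =>
    obtain ⟨w, rfl⟩ := h.mul'_surjective (k := k) v
    induction w using TensorProduct.induction_on with
    | zero => simp
    | add x y hx hy =>
      rw [map_add, TensorProduct.tmul_add]
      exact Submodule.add_mem _ hx hy
    | tmul v v' =>
      have h1 : ∀ t : A ⊗[k] A, (LinearMap.mul k A v).lTensor A t ∈
          LinearMap.range (lift (rmulHom ∘ₗ Δ)) := by
        intro t
        obtain ⟨z, rfl⟩ := h.bijective_left.2 t
        induction z using TensorProduct.induction_on with
        | zero => simp
        | add x y hx hy => simp only [map_add]; exact Submodule.add_mem _ hx hy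
        | tmul a b =>
          refine ⟨b ⊗ₜ (a ⊗ₜ v), ?_⟩
          apply incl_injective (k := k) h.nondegenerate_tensor
          rw [← lmul_incl_eq, ← lmul_tens_right, ← mul_incl h.nondegenerate_tensor,
            h.incl_comulL1, ← mul_assoc, tens_mul_tens, one_mul, mul_one, ← incl_tmul,
            incl_mul h.nondegenerate_tensor]
          rfl
      exact h1 (u ⊗ₜ v')

end IsMultiplierHopf

end Idempotent

end
end MultHopf

namespace MultHopf
noncomputable section
open TensorProduct (lift assoc curry)

/-! ### Extending `φ ⊗ ι` to multipliers -/

section HomTensorId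

variable {k : Type*} [Field k]
variable {A : Type*} [NonUnitalRing A] [Module k A] [IsScalarTower k A A] [SMulCommClass k A A]
variable {Y : Type*} [NonUnitalRing Y] [Module k Y] [IsScalarTower k Y Y] [SMulCommClass k Y Y]
variable {C : Type*} [NonUnitalRing C] [Module k C] [IsScalarTower k C C] [SMulCommClass k C C]

/-- `φ ⊗ ι` as a map `A ⊗ Y → M(C ⊗ Y)`, for `φ : A → M(C)`. -/
def homTensorId (φ : A →ₗ[k] Multiplier k C) : A ⊗[k] Y →ₗ[k] Multiplier k (C ⊗[k] Y) :=
  lift (tens.compl₁₂ φ (incl k Y))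

variable {φ : A →ₗ[k] Multiplier k C}

theorem homTensorId_tmul (a : A) (y : Y) :
    homTensorId φ (a ⊗ₜ y) = tens (φ a) (incl k Y y) := rfl

theorem incl_mul_incl (hC : IsNondegenerate C) (a b : C) :
    incl k C a * incl k C b = incl k C (a * b) := mul_incl hC _ _

theorem homTensorId_mul (hφ : ∀ a b, φ (a * b) = φ a * φ b) (hY : IsNondegenerate Y)
    (x y : A ⊗[k] Y) : homTensorId φ (x * y) = homTensorId φ x * homTensorId φ y := by
  induction x using TensorProduct.induction_on with
  | zero => rw [zero_mul, map_zero, zero_mul]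
  | add x y hx hy => rw [add_mul, map_add, map_add, add_mul, hx, hy]
  | tmul a u =>
    induction y using TensorProduct.induction_on with
    | zero => rw [mul_zero, map_zero, mul_zero]
    | add x y hx hy => rw [mul_add, map_add, map_add, mul_add, hx, hy]
    | tmul b v =>
      rw [Algebra.TensorProduct.tmul_mul_tmul, homTensorId_tmul, homTensorId_tmul,
        homTensorId_tmul, tens_mul_tens, hφ, incl_mul_incl hY]

theorem tmul_mem_of_surjective {U U' V V' : Type*} [AddCommGroup U] [Module k U]
    [AddCommGroup V] [Module k V] [AddCommGroup U'] [Module k U'] [AddCommGroup V'] [Module k V']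
    {F : U →ₗ[k] U'} {G : V →ₗ[k] V'} (hF : Function.Surjective F) (hG : Function.Surjective G)
    (S : Submodule k (U' ⊗[k] V')) (h : ∀ u v, F u ⊗ₜ G v ∈ S) (x : U' ⊗[k] V') : x ∈ S := by
  induction x using TensorProduct.induction_on with
  | zero => exact S.zero_mem
  | add x y hx hy => exact S.add_mem hx hy
  | tmul u v =>
    obtain ⟨u, rfl⟩ := hF u
    obtain ⟨v, rfl⟩ := hG v
    exact h u v

theorem lmul_homTensorId_surjective (hφ : Function.Surjective (lift (lmulHom ∘ₗ φ)))
    (hY : Function.Surjective (LinearMap.mul' k Y)) :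
    Function.Surjective (lift (lmulHom ∘ₗ homTensorId (Y := Y) φ)) := by
  rw [← LinearMap.range_eq_top, eq_top_iff]
  rintro x -
  refine tmul_mem_of_surjective hφ hY _ (fun z w => ?_) x
  induction z using TensorProduct.induction_on with
  | zero => simp
  | add x y hx hy => rw [map_add, TensorProduct.add_tmul]; exact Submodule.add_mem _ hx hy
  | tmul a p =>
    induction w using TensorProduct.induction_on with
    | zero => simp
    | add x y hx hy => rw [map_add, TensorProduct.tmul_add]; exact Submodule.add_mem _ hx hy
    | tmul y y' => exact ⟨(a ⊗ₜ y) ⊗ₜ (p ⊗ₜ y'), rfl⟩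

theorem rmul_homTensorId_surjective (hφ : Function.Surjective (lift (rmulHom ∘ₗ φ)))
    (hY : Function.Surjective (LinearMap.mul' k Y)) :
    Function.Surjective (lift (rmulHom ∘ₗ homTensorId (Y := Y) φ)) := by
  rw [← LinearMap.range_eq_top, eq_top_iff]
  rintro x -
  refine tmul_mem_of_surjective hφ hY _ (fun z w => ?_) x
  induction z using TensorProduct.induction_on with
  | zero => simp
  | add x y hx hy => rw [map_add, TensorProduct.add_tmul]; exact Submodule.add_mem _ hx hy
  | tmul a p =>
    induction w using TensorProduct.induction_on with
    | zero => simp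
    | add x y hx hy => rw [map_add, TensorProduct.tmul_add]; exact Submodule.add_mem _ hx hy
    | tmul y y' => exact ⟨(a ⊗ₜ y') ⊗ₜ (p ⊗ₜ y), rfl⟩

theorem homTensorId_rmul (hY : IsNondegenerate Y) (u : Y) (t : A ⊗[k] Y) :
    homTensorId φ (rmul (tens 1 (incl k Y u)) t) =
      homTensorId φ t * tens 1 (incl k Y u) := by
  induction t using TensorProduct.induction_on with
  | zero => rw [map_zero, map_zero, zero_mul]
  | add x y hx hy => rw [map_add, map_add, map_add, add_mul, hx, hy]
  | tmul x v =>
    rw [homTensorId_tmul, tens_mul_tens, incl_mul_incl hY, mul_one, ← homTensorId_tmul]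
    rfl

theorem homTensorId_lmul (hY : IsNondegenerate Y) (u : Y) (t : A ⊗[k] Y) :
    homTensorId φ (lmul (tens 1 (incl k Y u)) t) =
      tens 1 (incl k Y u) * homTensorId φ t := by
  induction t using TensorProduct.induction_on with
  | zero => rw [map_zero, map_zero, mul_zero]
  | add x y hx hy => rw [map_add, map_add, map_add, mul_add, hx, hy]
  | tmul x v =>
    rw [homTensorId_tmul, tens_mul_tens, incl_mul_incl hY, one_mul, ← homTensorId_tmul]
    rfl

/-- A homomorphism `φ : A → M(C)` is nondegenerate. -/
structure IsNondegenerateHom (φ : A →ₗ[k] Multiplier k C) : Prop where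
  map_mul : ∀ a b, φ (a * b) = φ a * φ b
  surjective_lmul : Function.Surjective (lift (lmulHom ∘ₗ φ))
  surjective_rmul : Function.Surjective (lift (rmulHom ∘ₗ φ))

theorem IsNondegenerateHom.homTensorId (hφ : IsNondegenerateHom φ) (hY : IsNondegenerate Y)
    (hY2 : Function.Surjective (LinearMap.mul' k Y)) :
    IsNondegenerateHom (homTensorId (Y := Y) φ) where
  map_mul := homTensorId_mul hφ.map_mul hY
  surjective_lmul := lmul_homTensorId_surjective hφ.surjective_lmul hY2
  surjective_rmul := rmul_homTensorId_surjective hφ.surjective_rmul hY2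

theorem IsNondegenerateHom.extend_spec (hφ : IsNondegenerateHom φ) (hC : IsNondegenerate C)
    (m : Multiplier k A) (x : A) :
    extend φ m * φ x = φ (lmul m x) ∧ φ x * extend φ m = φ (rmul m x) :=
  MultHopf.extend_spec (exists_extension hC φ hφ.map_mul hφ.surjective_lmul
    hφ.surjective_rmul m) x

/-- The extension is characterised only by its products with `φ(b) ⊗ u`, where `u ∈ Y`. The factor
`1 ⊗ u` is cancelled because `Y` is nondegenerate. -/
theorem extend_mul_hom (hφ : IsNondegenerateHom φ) (hA : IsNondegenerate A)
    (hC : IsNondegenerate C) (hY : IsNondegenerate Y)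
    (hY2 : Function.Surjective (LinearMap.mul' k Y)) (m : Multiplier k (A ⊗[k] Y)) (b : A)
    (t : A ⊗[k] Y) (ht : incl k (A ⊗[k] Y) t = m * tens (incl k A b) 1) :
    extend (homTensorId φ) m * tens (φ b) 1 = homTensorId φ t := by
  have hAY := hA.tensorProduct (k := k) hY
  refine mul_tens_right_cancel hC hY fun u => ?_
  have h1 := ((hφ.homTensorId hY hY2).extend_spec (hC.tensorProduct hY) m (b ⊗ₜ u)).1
  have h2 : lmul m (b ⊗ₜ u) = rmul (tens 1 (incl k Y u)) t := by
    apply incl_injective (k := k) hAY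
    rw [← mul_incl hAY, ← incl_mul hAY, ht, incl_tmul, mul_assoc, tens_mul_tens,
      one_mul, mul_one]
  rw [h2, homTensorId_rmul hY, homTensorId_tmul] at h1
  rw [← h1, mul_assoc, tens_mul_tens, one_mul, mul_one]

theorem hom_mul_extend (hφ : IsNondegenerateHom φ) (hA : IsNondegenerate A)
    (hC : IsNondegenerate C) (hY : IsNondegenerate Y)
    (hY2 : Function.Surjective (LinearMap.mul' k Y)) (m : Multiplier k (A ⊗[k] Y)) (b : A)
    (t : A ⊗[k] Y) (ht : incl k (A ⊗[k] Y) t = tens (incl k A b) 1 * m) :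
    tens (φ b) 1 * extend (homTensorId φ) m = homTensorId φ t := by
  have hAY := hA.tensorProduct (k := k) hY
  refine tens_right_mul_cancel hC hY fun u => ?_
  have h1 := ((hφ.homTensorId hY hY2).extend_spec (hC.tensorProduct hY) m (b ⊗ₜ u)).2
  have h2 : rmul m (b ⊗ₜ u) = lmul (tens 1 (incl k Y u)) t := by
    apply incl_injective (k := k) hAY
    rw [← mul_incl hAY, ← incl_mul hAY, ht, incl_tmul, ← mul_assoc, tens_mul_tens,
      one_mul, mul_one]
  rw [h2, homTensorId_lmul hY, homTensorId_tmul] at h1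
  rw [← h1, ← mul_assoc, tens_mul_tens, one_mul, mul_one]

/-- The multiplier `n` is left free so that, for `φ = Δ_A`, both coverings `n = 1 ⊗ b` and `n = b ⊗
1` are available. -/
theorem extend_mul_incl (hφ : IsNondegenerateHom φ) (hA : IsNondegenerate A)
    (hC : IsNondegenerate C) (hY : IsNondegenerate Y)
    (hY2 : Function.Surjective (LinearMap.mul' k Y)) (m : Multiplier k (A ⊗[k] Y)) (b : A)
    (t : A ⊗[k] Y) (ht : incl k (A ⊗[k] Y) t = m * tens (incl k A b) 1)
    (F : A →ₗ[k] C) (n : Multiplier k C) (hF : ∀ x, incl k C (F x) = φ x * n) :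
    extend (homTensorId φ) m * tens (incl k C (F b)) 1 =
      incl k (C ⊗[k] Y) (F.rTensor Y t) := by
  have h2 : ∀ t : A ⊗[k] Y, incl k (C ⊗[k] Y) (F.rTensor Y t) =
      homTensorId φ t * tens n 1 := by
    intro t
    induction t using TensorProduct.induction_on with
    | zero => rw [map_zero, map_zero, map_zero, zero_mul]
    | add x y hx hy => rw [map_add, map_add, map_add, add_mul, hx, hy]
    | tmul x u =>
      rw [LinearMap.rTensor_tmul, incl_tmul, hF, homTensorId_tmul, tens_mul_tens, mul_one]
  rw [h2, ← extend_mul_hom hφ hA hC hY hY2 m b t ht, hF, mul_assoc, tens_mul_tens, one_mul]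

theorem incl_mul_extend (hφ : IsNondegenerateHom φ) (hA : IsNondegenerate A)
    (hC : IsNondegenerate C) (hY : IsNondegenerate Y)
    (hY2 : Function.Surjective (LinearMap.mul' k Y)) (m : Multiplier k (A ⊗[k] Y)) (b : A)
    (t : A ⊗[k] Y) (ht : incl k (A ⊗[k] Y) t = tens (incl k A b) 1 * m)
    (F : A →ₗ[k] C) (n : Multiplier k C) (hF : ∀ x, incl k C (F x) = n * φ x) :
    tens (incl k C (F b)) 1 * extend (homTensorId φ) m =
      incl k (C ⊗[k] Y) (F.rTensor Y t) := by
  have h2 : ∀ t : A ⊗[k] Y, incl k (C ⊗[k] Y) (F.rTensor Y t) =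
      tens n 1 * homTensorId φ t := by
    intro t
    induction t using TensorProduct.induction_on with
    | zero => rw [map_zero, map_zero, map_zero, mul_zero]
    | add x y hx hy => rw [map_add, map_add, map_add, mul_add, hx, hy]
    | tmul x u =>
      rw [LinearMap.rTensor_tmul, incl_tmul, hF, homTensorId_tmul, tens_mul_tens, one_mul]
  rw [h2, ← hom_mul_extend hφ hA hC hY hY2 m b t ht, hF, ← mul_assoc, tens_mul_tens, one_mul]

end HomTensorId

end
end MultHopf

namespace MultHopf
noncomputable section
open TensorProduct (lift assoc curry)

/-! ### Comodules over a regular multiplier Hopf algebra -/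

section Comodule

variable {k : Type*} [Field k]
variable {A : Type*} [NonUnitalRing A] [Module k A] [IsScalarTower k A A] [SMulCommClass k A A]
variable {Y : Type*} [NonUnitalRing Y] [Module k Y] [IsScalarTower k Y Y] [SMulCommClass k Y Y]
variable {ΔA : A →ₗ[k] Multiplier k (A ⊗[k] A)} {ρ : Y →ₗ[k] Multiplier k (A ⊗[k] Y)}

theorem IsMultiplierHopf.isNondegenerateHom (hA : IsMultiplierHopf ΔA) :
    IsNondegenerateHom ΔA where
  map_mul := hA.map_mul
  surjective_lmul := hA.lmul_comul_surjective
  surjective_rmul := hA.rmul_comul_surjective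

theorem lift_curry_eq {U V W : Type*} [AddCommGroup U] [Module k U] [AddCommGroup V] [Module k V]
    [AddCommGroup W] [Module k W] (f : U ⊗[k] V →ₗ[k] W) : lift (curry f) = f := by
  ext; rfl

namespace IsComodule

theorem incl_coactT (h : IsComodule ΔA ρ) (y : Y) (a : A) :
    incl k (A ⊗[k] Y) (coactT ρ (y ⊗ₜ a)) = ρ y * tens (incl k A a) 1 :=
  incl_descend _ (lift_mem _ _ h.mem_right) (y ⊗ₜ a)

theorem incl_coactTbar (h : IsComodule ΔA ρ) (a : A) (y : Y) :
    incl k (A ⊗[k] Y) (coactTbar ρ (a ⊗ₜ y)) = tens (incl k A a) 1 * ρ y :=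
  incl_descend _ (lift_mem _ _ fun a y => h.mem_left y a) (a ⊗ₜ y)

theorem coactT_mul (h : IsComodule ΔA ρ) (hA : IsNondegenerate A) (hY : IsNondegenerate Y)
    (y : Y) (a b : A) :
    coactT ρ (y ⊗ₜ (a * b)) = ((LinearMap.mul k A).flip b).rTensor Y (coactT ρ (y ⊗ₜ a)) := by
  have hAY := hA.tensorProduct (k := k) hY
  apply incl_injective (k := k) hAY
  rw [← rmul_tens_left, ← incl_mul hAY, h.incl_coactT, h.incl_coactT, mul_assoc, tens_mul_tens,
    incl_mul_incl hA, one_mul]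

theorem coactTbar_mul (h : IsComodule ΔA ρ) (hA : IsNondegenerate A) (hY : IsNondegenerate Y)
    (y : Y) (a b : A) :
    coactTbar ρ ((b * a) ⊗ₜ y) = (LinearMap.mul k A b).rTensor Y (coactTbar ρ (a ⊗ₜ y)) := by
  have hAY := hA.tensorProduct (k := k) hY
  apply incl_injective (k := k) hAY
  rw [← lmul_tens_left, ← mul_incl hAY, h.incl_coactTbar, h.incl_coactTbar, ← mul_assoc,
    tens_mul_tens, incl_mul_incl hA, one_mul]

theorem coactTbar_coactT (h : IsComodule ΔA ρ) (hA : IsNondegenerate A)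
    (hY : IsNondegenerate Y) (a : A) (y : Y) (b : A) :
    ((LinearMap.mul k A).flip b).rTensor Y (coactTbar ρ (a ⊗ₜ y)) =
      (LinearMap.mul k A a).rTensor Y (coactT ρ (y ⊗ₜ b)) := by
  have hAY := hA.tensorProduct (k := k) hY
  apply incl_injective (k := k) hAY
  rw [← rmul_tens_left, ← incl_mul hAY, ← lmul_tens_left, ← mul_incl hAY, h.incl_coactT,
    h.incl_coactTbar, mul_assoc]

/-- `(ι ⊗ T)(T ⊗ ι)(y ⊗ Δ(c)n) = (Δ( )n ⊗ ι)T(y ⊗ c)` if `Δ(x)n ∈ A ⊗ A` for all `x`. -/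
theorem coactT_pentagon (h : IsComodule ΔA ρ) (hA : IsMultiplierHopf ΔA)
    (hY : IsNondegenerate Y) (hY2 : Function.Surjective (LinearMap.mul' k Y))
    (F : A →ₗ[k] A ⊗[k] A) (n : Multiplier k (A ⊗[k] A))
    (hF : ∀ x, incl k (A ⊗[k] A) (F x) = ΔA x * n) (y : Y) (c : A) :
    lift ((LinearMap.lTensorHom A ∘ₗ (curry (coactT ρ)).flip).flip ∘ₗ curry (coactT ρ) y) (F c) =
      assoc k A A Y (F.rTensor Y (coactT ρ (y ⊗ₜ c))) := by
  have h1 : ∀ r : A ⊗[k] A, incl k ((A ⊗[k] A) ⊗[k] Y) ((assoc k A A Y).symm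
      (lift ((LinearMap.lTensorHom A ∘ₗ (curry (coactT ρ)).flip).flip ∘ₗ
        curry (coactT ρ) y) r)) =
      extend (comulTensorId ΔA) (ρ y) * tens (incl k (A ⊗[k] A) r) 1 := by
    intro r
    induction r using TensorProduct.induction_on with
    | zero => simp only [map_zero, LinearMap.zero_apply, mul_zero]
    | add x y hx hy => simp only [map_add, mul_add, hx, hy, LinearMap.add_apply]
    | tmul a b => exact h.coassoc_right y a b
  apply (assoc k A A Y).symm.injective
  apply incl_injective (k := k) (hA.nondegenerate_tensor.tensorProduct hY)
  rw [h1, LinearEquiv.symm_apply_apply]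
  exact extend_mul_incl hA.isNondegenerateHom hA.nondegenerate hA.nondegenerate_tensor hY hY2
    (ρ y) c _ (h.incl_coactT y c) F n hF

/-- `T̄₂₃ T̄₁₃` at `nΔ(c) ⊗ y` equals `(nΔ( ) ⊗ ι)T̄(c ⊗ y)` if `nΔ(x) ∈ A ⊗ A` for all `x`. -/
theorem coactTbar_pentagon (h : IsComodule ΔA ρ) (hA : IsMultiplierHopf ΔA)
    (hY : IsNondegenerate Y) (hY2 : Function.Surjective (LinearMap.mul' k Y))
    (F : A →ₗ[k] A ⊗[k] A) (n : Multiplier k (A ⊗[k] A))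
    (hF : ∀ x, incl k (A ⊗[k] A) (F x) = n * ΔA x) (y : Y) (c : A) :
    lift ((LinearMap.lTensorHom A ∘ₗ curry (coactTbar ρ)).flip ∘ₗ
      (curry (coactTbar ρ)).flip y) (F c) =
      assoc k A A Y (F.rTensor Y (coactTbar ρ (c ⊗ₜ y))) := by
  have h1 : ∀ r : A ⊗[k] A, incl k ((A ⊗[k] A) ⊗[k] Y) ((assoc k A A Y).symm
      (lift ((LinearMap.lTensorHom A ∘ₗ curry (coactTbar ρ)).flip ∘ₗ
        (curry (coactTbar ρ)).flip y) r)) =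
      tens (incl k (A ⊗[k] A) r) 1 * extend (comulTensorId ΔA) (ρ y) := by
    intro r
    induction r using TensorProduct.induction_on with
    | zero => simp only [map_zero, LinearMap.zero_apply, zero_mul]
    | add x y hx hy => simp only [map_add, add_mul, hx, hy, LinearMap.add_apply]
    | tmul a b => exact h.coassoc_left y a b
  apply (assoc k A A Y).symm.injective
  apply incl_injective (k := k) (hA.nondegenerate_tensor.tensorProduct hY)
  rw [h1, LinearEquiv.symm_apply_apply]
  exact incl_mul_extend hA.isNondegenerateHom hA.nondegenerate hA.nondegenerate_tensor hY hY2
    (ρ y) c _ (h.incl_coactTbar c y) F n hF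

/-- The operators of a coaction. -/
def operators (h : IsComodule ΔA ρ) (hA : IsRegularMultiplierHopf ΔA)
    (hY : IsNondegenerate Y) (hY2 : Function.Surjective (LinearMap.mul' k Y)) :
    CoactionOperators k A Y where
  m := LinearMap.mul k A
  L := curry (comulL1 ΔA)
  R := curry (comulR2 ΔA)
  ε := counit ΔA
  T := curry (coactT ρ)
  S := (curry (coactTbar ρ)).flip
  nondegenerate := hA.nondegenerate.1
  bijective_L := by
    rw [lift_curry_eq]
    exact hA.isMultiplierHopf.bijective_left
  surjective_R := by
    rw [lift_curry_eq]
    exact hA.isMultiplierHopf.bijective_right.2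
  counit_mul := (isCounit_counit hA.isMultiplierHopf).map_mul
  counit_R := (isCounit_counit hA.isMultiplierHopf).evalLeft_comulR2
  coassoc := hA.isMultiplierHopf.coassoc
  L_mul := hA.comulL1_mul
  T_mul := h.coactT_mul hA.nondegenerate hY
  L_R := hA.isMultiplierHopf.comulL1_comulR2
  S_T := h.coactTbar_coactT hA.nondegenerate hY
  pentagon_T y a b := h.coactT_pentagon hA.isMultiplierHopf hY hY2
    ((curry (comulR2 ΔA)).flip b) (tens 1 (incl k A b))
    (fun x => hA.isMultiplierHopf.incl_comulR2 x b) y a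
  pentagon_S y a b := h.coactTbar_pentagon hA.isMultiplierHopf hY hY2
    (curry (comulL1 ΔA) a) (tens (incl k A a) 1)
    (fun x => hA.isMultiplierHopf.incl_comulL1 a x) y b
  faithful y hy := by
    apply h.injective
    rw [map_zero]
    refine mul_tens_left_cancel hA.nondegenerate hY fun a => ?_
    rw [← h.incl_coactT, zero_mul]
    exact (congrArg _ (hy a)).trans (map_zero _)

/-- The operators of a coaction, for the opposite multiplications. -/
def opOperators (h : IsComodule ΔA ρ) (hA : IsRegularMultiplierHopf ΔA)
    (hY : IsNondegenerate Y) (hY2 : Function.Surjective (LinearMap.mul' k Y)) :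
    CoactionOperators k A Y where
  m := (LinearMap.mul k A).flip
  L := (curry (comulR1 ΔA)).flip
  R := (curry (comulL2 ΔA)).flip
  ε := counit ΔA
  T := (curry (coactTbar ρ)).flip
  S := curry (coactT ρ)
  nondegenerate := hA.nondegenerate.2
  bijective_L := by
    have h1 : lift (curry (comulR1 ΔA)).flip =
        comulR1 ΔA ∘ₗ (TensorProduct.comm k A A).toLinearMap := by ext; rfl
    rw [h1]
    exact hA.bijective_comulR1.comp (LinearEquiv.bijective _)
  surjective_R := by
    have h1 : lift (curry (comulL2 ΔA)).flip =
        comulL2 ΔA ∘ₗ (TensorProduct.comm k A A).toLinearMap := by ext; rfl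
    rw [h1]
    exact (hA.bijective_comulL2.comp (LinearEquiv.bijective _)).2
  counit_mul a b := ((isCounit_counit hA.isMultiplierHopf).map_mul b a).trans (mul_comm _ _)
  counit_R a b := (isCounit_counit hA.isMultiplierHopf).evalLeft_comulL2 hA b a
  coassoc := hA.coassoc_op
  L_mul := hA.comulR1_mul
  T_mul := h.coactTbar_mul hA.nondegenerate hY
  L_R a b c := hA.comulL2_comulR1 c b a
  S_T a y b := (h.coactTbar_coactT hA.nondegenerate hY b y a).symm
  -- The coverings are those by `1 ⊗ b` on the left and, below, by `a ⊗ 1` on the right, so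
  -- regularity of `A` is used.
  pentagon_T y a b := h.coactTbar_pentagon hA.isMultiplierHopf hY hY2
    (curry (comulL2 ΔA) b) (tens 1 (incl k A b))
    (fun x => hA.incl_comulL2 b x) y a
  pentagon_S y a b := h.coactT_pentagon hA.isMultiplierHopf hY hY2
    ((curry (comulR1 ΔA)).flip a) (tens (incl k A a) 1)
    (fun x => hA.incl_comulR1 x a) y b
  faithful y hy := by
    apply h.injective
    rw [map_zero]
    refine tens_left_mul_cancel hA.nondegenerate hY fun a => ?_
    rw [← h.incl_coactTbar, mul_zero]
    exact (congrArg _ (hy a)).trans (map_zero _)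

/-- `injective_S` holds for both operator systems, so `T` and `T̄` are injective. Injectivity of
`T̄` is then the hypothesis under which `surjective_S`, in the opposite system, gives surjectivity
of `T`. -/
theorem bijective_coactT (h : IsComodule ΔA ρ) (hA : IsRegularMultiplierHopf ΔA)
    (hY : IsNondegenerate Y) (hY2 : Function.Surjective (LinearMap.mul' k Y)) :
    Function.Bijective (coactT ρ) := by
  have h1 : lift (h.opOperators hA hY hY2).S.flip =
      coactT ρ ∘ₗ (TensorProduct.comm k A Y).toLinearMap := by ext; rfl
  have h2 : lift (h.operators hA hY hY2).S.flip = coactTbar ρ := by ext; rfl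
  have h3 : lift (h.opOperators hA hY hY2).T =
      coactTbar ρ ∘ₗ (TensorProduct.comm k Y A).toLinearMap := by ext; rfl
  have i1 := (h.opOperators hA hY hY2).injective_S
  have i2 := (h.operators hA hY hY2).injective_S
  have i3 : Function.Injective (lift (h.opOperators hA hY hY2).T) := by
    rw [h3]
    rw [h2] at i2
    exact i2.comp (LinearEquiv.injective _)
  have i4 := (h.opOperators hA hY hY2).surjective_S i3
  rw [h1] at i1 i4
  constructor
  · exact (Function.Injective.of_comp_iff' _ (TensorProduct.comm k A Y).bijective).1 i1
  · exact Function.Surjective.of_comp i4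

end IsComodule
end Comodule
end
end MultHopf

namespace MultHopf
noncomputable section
open TensorProduct (lift assoc curry)

/-! ### Consequences for comodules: the counit identity, iterated coactions, the antipode -/

section ComoduleCoalgebra

variable {k : Type*} [Field k]
variable {A : Type*} [NonUnitalRing A] [Module k A] [IsScalarTower k A A] [SMulCommClass k A A]
variable {Y : Type*} [NonUnitalRing Y] [Module k Y] [IsScalarTower k Y Y] [SMulCommClass k Y Y]
variable {ΔA : A →ₗ[k] Multiplier k (A ⊗[k] A)} {ρ : Y →ₗ[k] Multiplier k (A ⊗[k] Y)}

namespace IsComodule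

theorem evalLeft_coactT (h : IsComodule ΔA ρ) (hA : IsRegularMultiplierHopf ΔA)
    (hY : IsNondegenerate Y) (hY2 : Function.Surjective (LinearMap.mul' k Y)) (y : Y) (a : A) :
    evalLeft (counit ΔA) (coactT ρ (y ⊗ₜ a)) = counit ΔA a • y :=
  (h.operators hA hY hY2).counit_T y a

theorem evalLeft_coactTbar (h : IsComodule ΔA ρ) (hA : IsRegularMultiplierHopf ΔA)
    (hY : IsNondegenerate Y) (hY2 : Function.Surjective (LinearMap.mul' k Y)) (a : A) (y : Y) :
    evalLeft (counit ΔA) (coactTbar ρ (a ⊗ₜ y)) = counit ΔA a • y :=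
  (h.operators hA hY hY2).counit_S y a

theorem lmul_tmul (h : IsComodule ΔA ρ) (hAY : IsNondegenerate (A ⊗[k] Y)) (y : Y) (b : A)
    (u : Y) : lmul (ρ y) (b ⊗ₜ u) = rmul (tens 1 (incl k Y u)) (coactT ρ (y ⊗ₜ b)) := by
  apply incl_injective (k := k) hAY
  rw [← mul_incl hAY, ← incl_mul hAY, h.incl_coactT, incl_tmul, mul_assoc, tens_mul_tens,
    one_mul, mul_one]

theorem rmul_tmul (h : IsComodule ΔA ρ) (hAY : IsNondegenerate (A ⊗[k] Y)) (y : Y) (b : A)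
    (u : Y) : rmul (ρ y) (b ⊗ₜ u) = lmul (tens 1 (incl k Y u)) (coactTbar ρ (b ⊗ₜ y)) := by
  apply incl_injective (k := k) hAY
  rw [← mul_incl hAY, ← incl_mul hAY, h.incl_coactTbar, incl_tmul, ← mul_assoc, tens_mul_tens,
    one_mul, mul_one]

theorem counitTensorId_apply (ε : A →ₗ[k] k) (x : A ⊗[k] Y) :
    counitTensorId ε x = incl k Y (evalLeft ε x) := rfl

theorem counit_coact (h : IsComodule ΔA ρ) (hA : IsRegularMultiplierHopf ΔA)
    (hY : IsNondegenerate Y) (hY2 : Function.Surjective (LinearMap.mul' k Y)) (y : Y) :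
    extend (counitTensorId (counit ΔA)) (ρ y) = incl k Y y := by
  have hAY := hA.nondegenerate.tensorProduct (k := k) hY
  -- The value of `extend` is a default unless an extension exists, so `y` is first shown to satisfy
  -- the defining property. Uniqueness is checked afterwards.
  have hex : ∃ n : Multiplier k Y, ∀ b, n * counitTensorId (counit ΔA) b =
      counitTensorId (counit ΔA) (lmul (ρ y) b) ∧
      counitTensorId (counit ΔA) b * n = counitTensorId (counit ΔA) (rmul (ρ y) b) := by
    refine ⟨incl k Y y, fun b => ?_⟩
    simp only [counitTensorId_apply, incl_mul_incl hY]
    induction b using TensorProduct.induction_on with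
    | zero => simp
    | add u v hu hv =>
      simp only [map_add, mul_add, add_mul]
      exact ⟨by rw [hu.1, hv.1], by rw [hu.2, hv.2]⟩
    | tmul a u =>
      rw [h.lmul_tmul hAY, h.rmul_tmul hAY, rmul_tens_right, lmul_tens_right, evalLeft_lTensor,
        evalLeft_lTensor, h.evalLeft_coactT hA hY hY2, h.evalLeft_coactTbar hA hY hY2]
      exact ⟨by simp [mul_smul_comm], by simp [smul_mul_assoc]⟩
  have hs := extend_spec hex
  refine ext_lmul hY fun u => ?_
  cases subsingleton_or_nontrivial A with
  | inl hs =>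
    -- If `A = 0`, injectivity of `ρ` forces `Y = 0`.
    have : ∀ v : Y, v = 0 := fun v =>
      (h.operators hA hY hY2).faithful v fun a => by rw [Subsingleton.elim a 0, map_zero]
    exact (this _).trans (this _).symm
  | inr _ =>
    obtain ⟨a, ha⟩ := (isCounit_counit hA.isMultiplierHopf).exists_ne_zero hA.nondegenerate
    have h1 := (hs (a ⊗ₜ ((counit ΔA a)⁻¹ • u))).1
    rw [counitTensorId_apply, counitTensorId_apply, h.lmul_tmul hAY, rmul_tens_right,
      evalLeft_lTensor, h.evalLeft_coactT hA hY hY2, evalLeft_tmul, smul_inv_smul₀ ha,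
      mul_incl hY] at h1
    rw [incl_injective (k := k) hY h1, rmul_incl, lmul_incl, smul_mul_smul_comm,
      mul_inv_cancel₀ ha, one_smul]

theorem coactT_coactT (h : IsComodule ΔA ρ) (hA : IsRegularMultiplierHopf ΔA)
    (hY : IsNondegenerate Y) (hY2 : Function.Surjective (LinearMap.mul' k Y)) (y : Y) (a a' : A) :
    iterT ΔA ρ y a a' = assoc k A A Y
      ((comulR2 ΔA ∘ₗ (TensorProduct.mk k A A).flip a').rTensor Y (coactT ρ (y ⊗ₜ a))) := by
  have h1 : ∀ r : A ⊗[k] A, (coactT ρ).lTensor A (assoc k A Y A ((coactT ρ).rTensor A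
      ((assoc k Y A A).symm (y ⊗ₜ r)))) =
      lift ((LinearMap.lTensorHom A ∘ₗ (curry (coactT ρ)).flip).flip ∘ₗ
        curry (coactT ρ) y) r := by
    intro r
    induction r using TensorProduct.induction_on with
    | zero => simp
    | add x y hx hy => simp only [map_add, TensorProduct.tmul_add, hx, hy]
    | tmul a b =>
      simp only [TensorProduct.assoc_symm_tmul, LinearMap.rTensor_tmul, TensorProduct.lift.tmul,
        LinearMap.comp_apply, LinearMap.flip_apply, TensorProduct.curry_apply,
        LinearMap.coe_lTensorHom]
      induction coactT ρ (y ⊗ₜ a) using TensorProduct.induction_on with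
      | zero => simp
      | add x y hx hy => simp only [map_add, TensorProduct.add_tmul, hx, hy]
      | tmul x y => simp
  exact (h1 _).trans ((h.operators hA hY hY2).pentagon_T y a a')

theorem coactTbar_coactTbar (h : IsComodule ΔA ρ) (hA : IsRegularMultiplierHopf ΔA)
    (hY : IsNondegenerate Y) (hY2 : Function.Surjective (LinearMap.mul' k Y)) (y : Y) (a b : A) :
    iterTbar ΔA ρ b a y = assoc k A A Y
      ((comulL2 ΔA ∘ₗ TensorProduct.mk k A A b).rTensor Y (coactTbar ρ (a ⊗ₜ y))) := by
  have h1 : ∀ r : A ⊗[k] A, (coactTbar ρ).lTensor A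
      ((TensorProduct.comm k Y A).toLinearMap.lTensor A
        (assoc k A Y A ((coactTbar ρ).rTensor A
          ((assoc k A Y A).symm ((TensorProduct.comm k A Y).toLinearMap.lTensor A
            (assoc k A A Y (r ⊗ₜ y))))))) =
      lift ((LinearMap.lTensorHom A ∘ₗ curry (coactTbar ρ)).flip ∘ₗ
        (curry (coactTbar ρ)).flip y) r := by
    intro r
    induction r using TensorProduct.induction_on with
    | zero => simp
    | add x y hx hy => simp only [map_add, TensorProduct.add_tmul, hx, hy]
    | tmul a b =>
      simp only [TensorProduct.assoc_symm_tmul, LinearMap.rTensor_tmul, TensorProduct.lift.tmul,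
        LinearMap.comp_apply, LinearMap.flip_apply, TensorProduct.curry_apply,
        LinearMap.coe_lTensorHom, TensorProduct.assoc_tmul, LinearMap.lTensor_tmul,
        LinearEquiv.coe_coe, TensorProduct.comm_tmul]
      induction coactTbar ρ (a ⊗ₜ y) using TensorProduct.induction_on with
      | zero => simp
      | add x y hx hy => simp only [map_add, TensorProduct.add_tmul, hx, hy]
      | tmul x y => simp
  exact (h1 _).trans ((h.opOperators hA hY hY2).pentagon_T y a b)

/-- The bijection `T`. -/
def coactTEquiv (h : IsComodule ΔA ρ) (hA : IsRegularMultiplierHopf ΔA)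
    (hY : IsNondegenerate Y) (hY2 : Function.Surjective (LinearMap.mul' k Y)) :
    Y ⊗[k] A ≃ₗ[k] A ⊗[k] Y :=
  LinearEquiv.ofBijective (coactT ρ) (h.bijective_coactT hA hY hY2)

theorem coactTEquiv_apply (h : IsComodule ΔA ρ) (hA : IsRegularMultiplierHopf ΔA)
    (hY : IsNondegenerate Y) (hY2 : Function.Surjective (LinearMap.mul' k Y)) (z : Y ⊗[k] A) :
    h.coactTEquiv hA hY hY2 z = coactT ρ z := rfl

/-- There is a map `s : A → A → A` (namely `a S(b)`) that exchanges `T̄` and the inverse of `T`. -/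
theorem exists_antipode (h : IsComodule ΔA ρ) (hA : IsRegularMultiplierHopf ΔA)
    (hY : IsNondegenerate Y) (hY2 : Function.Surjective (LinearMap.mul' k Y)) :
    ∃ s : A →ₗ[k] A →ₗ[k] A, Function.Surjective (lift s) ∧ ∀ a z,
      coactTbar ρ ((s a).rTensor Y (coactT ρ z)) =
        TensorProduct.comm k Y A ((s a).lTensor Y z) := by
  refine ⟨(h.operators hA hY hY2).mulAntipode, fun a => ?_, fun a z => ?_⟩
  · cases subsingleton_or_nontrivial A with
    | inl _ => exact ⟨0, Subsingleton.elim _ _⟩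
    | inr _ => exact (h.operators hA hY hY2).lift_mulAntipode_surjective a
  · induction z using TensorProduct.induction_on with
    | zero => simp
    | add x y hx hy => simp only [map_add, hx, hy]
    | tmul y b =>
      have hT : Function.Injective (lift (h.operators hA hY hY2).T) := by
        have h1 : lift (h.operators hA hY hY2).T = coactT ρ := lift_curry_eq _
        rw [h1]
        exact (h.bijective_coactT hA hY hY2).1
      have h2 : lift (h.operators hA hY hY2).S.flip = coactTbar ρ := lift_curry_eq _
      have h3 := (h.operators hA hY hY2).S_mulAntipode_T hT a b y
      rw [h2] at h3
      exact h3

end IsComodule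

end ComoduleCoalgebra
end
end MultHopf

namespace MultHopf
noncomputable section
open TensorProduct (lift assoc curry)

/-! ### Comodule coalgebras: the counit of `Y` and conditions (6), (7), (8) -/

section ComoduleCoalgebra

variable {k : Type*} [Field k]
variable {A : Type*} [NonUnitalRing A] [Module k A] [IsScalarTower k A A] [SMulCommClass k A A]
variable {Y : Type*} [NonUnitalRing Y] [Module k Y] [IsScalarTower k Y Y] [SMulCommClass k Y Y]
variable {ΔA : A →ₗ[k] Multiplier k (A ⊗[k] A)} {ΔY : Y →ₗ[k] Multiplier k (Y ⊗[k] Y)}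
  {ρ : Y →ₗ[k] Multiplier k (A ⊗[k] Y)}

theorem IsCounit.subsingleton_or_exists_ne_zero {ε : Y →ₗ[k] k} (hε : IsCounit ΔY ε)
    (hY : IsNondegenerate Y) : (∃ p, ε p ≠ 0) ∨ ∀ y : Y, y = 0 := by
  cases subsingleton_or_nontrivial Y with
  | inl _ => exact Or.inr fun y => Subsingleton.elim y 0
  | inr _ => exact Or.inl (hε.exists_ne_zero hY)

theorem tmul_eq_zero_of_right {U V : Type*} [AddCommGroup U] [Module k U] [AddCommGroup V]
    [Module k V] (h : ∀ v : V, v = 0) (z : U ⊗[k] V) : z = 0 := by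
  induction z using TensorProduct.induction_on with
  | zero => rfl
  | add x y hx hy => rw [hx, hy, add_zero]
  | tmul u v => rw [h v, TensorProduct.tmul_zero]

/-- Apply `ε_Y` to the first leg of the defining equation at `p`. Both sides acquire the factor
`ε_Y(p)`, by `(ε_Y ⊗ ι)(Δ_Y(y)(p ⊗ 1)) = ε_Y(p)y`; it cancels for a suitable `p` unless `Y = 0`. -/
theorem evalLeft_cover (hY : IsRegularMultiplierHopf ΔY) {y : Y} {a : A} {y' : Y}
    {w : Y ⊗[k] (A ⊗[k] Y)} (hw : IsCoverRight ΔY ρ y a y' w) :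
    evalLeft (counit ΔY) w = rmul (tens 1 (incl k Y y')) (coactT ρ (y ⊗ₜ a)) := by
  have hε := isCounit_counit hY.isMultiplierHopf
  obtain ⟨p, hp⟩ | h0 := hε.subsingleton_or_exists_ne_zero hY.nondegenerate
  · have h1 := congrArg (evalLeft (counit ΔY)) (hw.right p)
    rw [rmul_tens_left, evalLeft_rTensor _ _ _ (hε.map_mul_right p), rmul_tens_right,
      evalLeft_lTensor, evalLeft_lTensor, evalLeft_assoc, LinearMap.rTensor_tmul,
      hε.evalLeft_comulR1 hY, ← TensorProduct.smul_tmul', map_smul, map_smul] at h1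
    exact smul_right_injective _ hp h1
  · rw [tmul_eq_zero_of_right h0 (evalLeft (counit ΔY) w), h0 y, TensorProduct.zero_tmul,
      map_zero, map_zero]

/-- `(ι ⊗ T)((Δ(y)(p ⊗ 1)) ⊗ a)` as a function of `y ⊗ a`. -/
def coactTComul (ΔY : Y →ₗ[k] Multiplier k (Y ⊗[k] Y)) (ρ : Y →ₗ[k] Multiplier k (A ⊗[k] Y))
    (p : Y) : Y ⊗[k] A →ₗ[k] Y ⊗[k] (A ⊗[k] Y) :=
  (coactT ρ).lTensor Y ∘ₗ (assoc k Y Y A).toLinearMap ∘ₗ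
    (comulR1 ΔY ∘ₗ (TensorProduct.mk k Y Y).flip p).rTensor A

namespace IsComoduleCoalgebra

/-- Linear extension of (3) and (4) to arbitrary `z`, needed because `T⁻¹(c ⊗ u)` is in general not
a pure tensor. -/
theorem exists_cover_right (h : IsComoduleCoalgebra ΔA ΔY ρ) (hY : IsRegularMultiplierHopf ΔY)
    (y' : Y) (z : Y ⊗[k] A) : ∃ w : Y ⊗[k] (A ⊗[k] Y),
      (∀ p, rmul (tens (incl k Y p) 1) w =
        rmul (tens 1 (tens 1 (incl k Y y'))) (coactTComul ΔY ρ p z)) ∧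
      (comulR2 ΔY ∘ₗ (TensorProduct.mk k Y Y).flip y').lTensor A (coactT ρ z) =
        assoc k A Y Y ((coactT ρ).rTensor Y ((assoc k Y A Y).symm w)) ∧
      evalLeft (counit ΔY) w = rmul (tens 1 (incl k Y y')) (coactT ρ z) := by
  induction z using TensorProduct.induction_on with
  | zero => exact ⟨0, fun p => by simp, by simp, by simp⟩
  | add u v hu hv =>
    obtain ⟨w, h1, h2, h3⟩ := hu
    obtain ⟨w', h1', h2', h3'⟩ := hv
    exact ⟨w + w', fun p => by simp only [map_add, h1, h1'], by simp only [map_add, h2, h2'],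
      by simp only [map_add, h3, h3']⟩
  | tmul y a =>
    obtain ⟨w, hw⟩ := (h.covered y a y').1
    exact ⟨w, hw.right, h.compatible.right y a y' w hw, evalLeft_cover hY hw⟩

theorem exists_cover_left (h : IsComoduleCoalgebra ΔA ΔY ρ) (y' : Y) (z : Y ⊗[k] A) :
    ∃ w : Y ⊗[k] (A ⊗[k] Y),
      (∀ p, rmul (tens (incl k Y p) 1) w =
        lmul (tens 1 (tens 1 (incl k Y y'))) (coactTComul ΔY ρ p z)) ∧
      (comulL2 ΔY ∘ₗ TensorProduct.mk k Y Y y').lTensor A (coactT ρ z) =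
        assoc k A Y Y ((coactT ρ).rTensor Y ((assoc k Y A Y).symm w)) := by
  induction z using TensorProduct.induction_on with
  | zero => exact ⟨0, fun p => by simp, by simp⟩
  | add u v hu hv =>
    obtain ⟨w, h1, h2⟩ := hu
    obtain ⟨w', h1', h2'⟩ := hv
    exact ⟨w + w', fun p => by simp only [map_add, h1, h1'], by simp only [map_add, h2, h2']⟩
  | tmul y a =>
    obtain ⟨w, hw⟩ := (h.covered y a y').2
    exact ⟨w, hw.right, h.compatible.left y a y' w hw⟩

section

variable {e : Y ⊗[k] A ≃ₗ[k] A ⊗[k] Y}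

theorem eq_of_assoc_coactT (he : ∀ z, e z = coactT ρ z) {q : A ⊗[k] (Y ⊗[k] Y)}
    {w : Y ⊗[k] (A ⊗[k] Y)}
    (hw : q = assoc k A Y Y ((coactT ρ).rTensor Y ((assoc k Y A Y).symm w))) :
    w = assoc k Y A Y (e.symm.toLinearMap.rTensor Y ((assoc k A Y Y).symm q)) := by
  have h1 : e.symm.toLinearMap ∘ₗ coactT ρ = LinearMap.id :=
    LinearMap.ext fun z => by
      rw [LinearMap.comp_apply, ← he]
      exact e.symm_apply_apply z
  rw [hw, LinearEquiv.symm_apply_apply, ← LinearMap.rTensor_comp_apply, h1,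
    LinearMap.rTensor_id_apply, LinearEquiv.apply_symm_apply]

theorem coactT_symm_cover_right (h : IsComoduleCoalgebra ΔA ΔY ρ)
    (hY : IsRegularMultiplierHopf ΔY) (he : ∀ z, e z = coactT ρ z) (c : A) (u y' : Y) :
    (∀ p, rmul (tens (incl k Y p) 1) (assoc k Y A Y (e.symm.toLinearMap.rTensor Y
        ((assoc k A Y Y).symm (c ⊗ₜ comulR2 ΔY (u ⊗ₜ y'))))) =
      rmul (tens 1 (tens 1 (incl k Y y'))) (coactTComul ΔY ρ p (e.symm (c ⊗ₜ u)))) ∧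
    evalLeft (counit ΔY) (assoc k Y A Y (e.symm.toLinearMap.rTensor Y
        ((assoc k A Y Y).symm (c ⊗ₜ comulR2 ΔY (u ⊗ₜ y'))))) = c ⊗ₜ (u * y') := by
  obtain ⟨w, h1, h2, h3⟩ := h.exists_cover_right hY y' (e.symm (c ⊗ₜ u))
  have h4 := eq_of_assoc_coactT he h2
  rw [← he, LinearEquiv.apply_symm_apply] at h3 h4
  subst h4
  exact ⟨h1, h3⟩

theorem coactT_symm_cover_left (h : IsComoduleCoalgebra ΔA ΔY ρ)
    (he : ∀ z, e z = coactT ρ z) (c : A) (u y' p : Y) :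
    rmul (tens (incl k Y p) 1) (assoc k Y A Y (e.symm.toLinearMap.rTensor Y
        ((assoc k A Y Y).symm (c ⊗ₜ comulL2 ΔY (y' ⊗ₜ u))))) =
      lmul (tens 1 (tens 1 (incl k Y y'))) (coactTComul ΔY ρ p (e.symm (c ⊗ₜ u))) := by
  obtain ⟨w, h1, h2⟩ := h.exists_cover_left y' (e.symm (c ⊗ₜ u))
  have h4 := eq_of_assoc_coactT he h2
  rw [← he, LinearEquiv.apply_symm_apply] at h4
  subst h4
  exact h1 p

/-- `(ι ⊗ ε)T = ε ⊗ ι`. -/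
theorem evalRight_coactT (h : IsComoduleCoalgebra ΔA ΔY ρ) (hY : IsRegularMultiplierHopf ΔY)
    (he : ∀ z, e z = coactT ρ z) (z : Y ⊗[k] A) :
    evalRight (counit ΔY) (coactT ρ z) = evalLeft (counit ΔY) z := by
  have hε := isCounit_counit hY.isMultiplierHopf
  -- It suffices to take `r = Δ_Y(u)(1 ⊗ y')`, where `coactT_symm_cover_right` gives `c ⊗ uy'`.
  have h1 : ∀ (c : A) (r : Y ⊗[k] Y), (evalLeft (counit ΔY) ∘ₗ e.symm.toLinearMap).rTensor Y
      ((assoc k A Y Y).symm (c ⊗ₜ r)) = c ⊗ₜ evalLeft (counit ΔY) r := by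
    intro c r
    obtain ⟨s, rfl⟩ := hY.isMultiplierHopf.bijective_right.2 r
    induction s using TensorProduct.induction_on with
    | zero => simp
    | add x y hx hy => simp only [map_add, TensorProduct.tmul_add, hx, hy]
    | tmul u y' =>
      rw [hε.evalLeft_comulR2, ← (h.coactT_symm_cover_right hY he c u y').2, evalLeft_assoc,
        LinearMap.rTensor_comp_apply]
  have h2 : ∀ t : A ⊗[k] Y, evalLeft (counit ΔY) (e.symm t) = evalRight (counit ΔY) t := by
    intro t
    induction t using TensorProduct.induction_on with
    | zero => simp
    | add x y hx hy => simp only [map_add, hx, hy]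
    | tmul c p =>
      by_cases hp : p = 0
      · simp [hp]
      · refine tmul_right_cancel (k := k) p hp ?_
        simpa [TensorProduct.smul_tmul] using h1 c (p ⊗ₜ p)
  rw [← h2, ← he, LinearEquiv.symm_apply_apply]

end

/-- From `T̄(a ⊗ y)(b ⊗ 1) = (a ⊗ 1)T(y ⊗ b)`, the formula for `T` gives `ε_Y(y)ab`; then `b` is
cancelled. -/
theorem evalRight_coactTbar (h : IsComoduleCoalgebra ΔA ΔY ρ) (hA : IsRegularMultiplierHopf ΔA)
    (hY : IsRegularMultiplierHopf ΔY) (z : A ⊗[k] Y) :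
    evalRight (counit ΔY) (coactTbar ρ z) = evalRight (counit ΔY) z := by
  induction z using TensorProduct.induction_on with
  | zero => simp
  | add x y hx hy => simp only [map_add, hx, hy]
  | tmul a y =>
    rw [← sub_eq_zero]
    refine hA.nondegenerate.1 _ fun b => ?_
    have h1 := congrArg (evalRight (counit ΔY))
      (h.isComodule.coactTbar_coactT hA.nondegenerate hY.nondegenerate a y b)
    have hY2 := hY.isMultiplierHopf.mul'_surjective
    rw [evalRight_rTensor, evalRight_rTensor, h.evalRight_coactT hY
      (h.isComodule.coactTEquiv_apply hA hY.nondegenerate hY2)] at h1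
    rw [sub_mul, sub_eq_zero]
    refine h1.trans ?_
    simp [smul_mul_assoc]

theorem counitT_eq (h : IsComoduleCoalgebra ΔA ΔY ρ) (hA : IsRegularMultiplierHopf ΔA)
    (hY : IsRegularMultiplierHopf ΔY) (a' : A) (w : Y ⊗[k] (A ⊗[k] Y)) :
    counitT ΔA ΔY ρ a' w = assoc k A A Y
      ((comulR2 ΔA ∘ₗ (TensorProduct.mk k A A).flip a').rTensor Y
        (evalLeft (counit ΔY) w)) := by
  have hY2 := hY.isMultiplierHopf.mul'_surjective
  have h1 : (TensorProduct.rid k A).toLinearMap ∘ₗ (counit ΔY).lTensor A ∘ₗ coactT ρ =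
      evalLeft (counit ΔY) :=
    LinearMap.ext fun z => h.evalRight_coactT hY
      (h.isComodule.coactTEquiv_apply hA hY.nondegenerate hY2) z
  unfold counitT
  rw [h1]
  generalize (comulR2 ΔA ∘ₗ (TensorProduct.mk k A A).flip a') = F
  induction w using TensorProduct.induction_on with
  | zero => simp
  | add x y hx hy => simp only [map_add, hx, hy]
  | tmul x t =>
    rw [LinearMap.lTensor_tmul, LinearMap.lTensor_tmul, evalLeft_tmul, map_smul, map_smul]
    generalize F.rTensor Y t = r
    change _ = counit ΔY x • (assoc k A A Y).toLinearMap r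
    generalize (assoc k A A Y).toLinearMap r = r
    induction r using TensorProduct.induction_on with
    | zero => simp
    | add x y hx hy => simp only [map_add, TensorProduct.tmul_add, smul_add, hx, hy]
    | tmul b v => simp [TensorProduct.smul_tmul']

/-- Both sides are `(Δ_A(·)(1 ⊗ a') ⊗ ι)T(y ⊗ a)` times `y'` on the last leg: the left one by
coassociativity of `ρ`, the right one since `ε_Y` on the first leg of `w` is `T(y ⊗ a)(1 ⊗ y')`. -/
theorem coassoc (h : IsComoduleCoalgebra ΔA ΔY ρ) (hA : IsRegularMultiplierHopf ΔA)
    (hY : IsRegularMultiplierHopf ΔY) (y : Y) (a a' : A) (y' : Y) (w : Y ⊗[k] (A ⊗[k] Y))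
    (hw : IsCoverRight ΔY ρ y a y' w) :
    rmul (tens 1 (tens 1 (incl k Y y'))) (iterT ΔA ρ y a a') = counitT ΔA ΔY ρ a' w := by
  have hY2 := hY.isMultiplierHopf.mul'_surjective
  rw [h.counitT_eq hA hY, evalLeft_cover hY hw,
    h.isComodule.coactT_coactT hA hY.nondegenerate hY2, rmul_tens_right, rmul_tens_right,
    lTensor_lTensor_assoc, lTensor_rTensor_comm]

theorem counitTbar_eq (h : IsComoduleCoalgebra ΔA ΔY ρ) (hA : IsRegularMultiplierHopf ΔA)
    (hY : IsRegularMultiplierHopf ΔY) (b : A) (x : A ⊗[k] (Y ⊗[k] Y)) :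
    counitTbar ΔA ΔY ρ b x = assoc k A A Y
      ((comulL2 ΔA ∘ₗ TensorProduct.mk k A A b).rTensor Y
        ((evalRight (counit ΔY)).lTensor A x)) := by
  have h1 : (TensorProduct.rid k A).toLinearMap ∘ₗ (counit ΔY).lTensor A ∘ₗ coactTbar ρ =
      evalRight (counit ΔY) :=
    LinearMap.ext fun z => h.evalRight_coactTbar hA hY z
  unfold counitTbar
  rw [h1]
  generalize (comulL2 ΔA ∘ₗ TensorProduct.mk k A A b) = F
  refine LinearMap.congr_fun (f := TensorProduct.map (evalRight (counit ΔY)) LinearMap.id ∘ₗ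
    (assoc k A Y (A ⊗[k] Y)).symm.toLinearMap ∘ₗ
    (TensorProduct.comm k (A ⊗[k] Y) Y).toLinearMap.lTensor A ∘ₗ
    (assoc k A (A ⊗[k] Y) Y).toLinearMap ∘ₗ (assoc k A A Y).toLinearMap.rTensor Y ∘ₗ
    (F.rTensor Y).rTensor Y ∘ₗ (assoc k A Y Y).symm.toLinearMap)
    (g := (assoc k A A Y).toLinearMap ∘ₗ F.rTensor Y ∘ₗ (evalRight (counit ΔY)).lTensor A) ?_ x
  ext c u v
  simp only [TensorProduct.AlgebraTensorModule.curry_apply, TensorProduct.curry_apply,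
    LinearMap.coe_restrictScalars, LinearMap.comp_apply, LinearEquiv.coe_coe,
    TensorProduct.assoc_symm_tmul, LinearMap.rTensor_tmul, LinearMap.lTensor_tmul,
    evalRight_tmul]
  generalize F c = r
  induction r using TensorProduct.induction_on with
  | zero => simp
  | add x y hx hy => simp only [map_add, TensorProduct.add_tmul, hx, hy]
  | tmul b v => simp [TensorProduct.smul_tmul', TensorProduct.tmul_smul]

theorem evalRight_assoc_tmul (ε : Y →ₗ[k] k) (g : Y →ₗ[k] Y) (t : A ⊗[k] Y) (v : Y) :
    (evalRight ε).lTensor A ((g.rTensor Y).lTensor A (assoc k A Y Y (t ⊗ₜ v))) =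
      ε v • g.lTensor A t := by
  refine LinearMap.congr_fun (f := (evalRight ε).lTensor A ∘ₗ (g.rTensor Y).lTensor A ∘ₗ
    (assoc k A Y Y).toLinearMap ∘ₗ (TensorProduct.mk k (A ⊗[k] Y) Y).flip v)
    (g := ε v • g.lTensor A) ?_ t
  ext b u
  simp

theorem evalRight_coverBar_aux (ε : Y →ₗ[k] k) (g : Y →ₗ[k] Y) (a : A) (r : Y ⊗[k] Y) :
    (evalRight ε).lTensor A ((g.rTensor Y).lTensor A (assoc k A Y Y ((coactTbar ρ).rTensor Y
      ((assoc k A Y Y).symm (a ⊗ₜ r))))) =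
      g.lTensor A (coactTbar ρ (a ⊗ₜ evalRight ε r)) := by
  induction r using TensorProduct.induction_on with
  | zero => simp
  | add x y hx hy => simp only [map_add, TensorProduct.tmul_add, hx, hy]
  | tmul s v =>
    rw [TensorProduct.assoc_symm_tmul, LinearMap.rTensor_tmul, evalRight_tmul,
      TensorProduct.tmul_smul, map_smul, map_smul, evalRight_assoc_tmul]

/-- The counterpart of `evalLeft_cover`: `ε_Y` is applied to the third leg and a factor `ε_Y(q)` is
cancelled. -/
theorem evalRight_coverBar (hY : IsRegularMultiplierHopf ΔY) {a : A} {y y' : Y}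
    {x : A ⊗[k] (Y ⊗[k] Y)} (hx : IsCoverBar ΔY ρ a y y' x) :
    (evalRight (counit ΔY)).lTensor A x =
      rmul (tens 1 (incl k Y y')) (coactTbar ρ (a ⊗ₜ y)) := by
  have hε := isCounit_counit hY.isMultiplierHopf
  obtain ⟨q, hq⟩ | h0 := hε.subsingleton_or_exists_ne_zero hY.nondegenerate
  · have h2 : evalRight (counit ΔY) ∘ₗ (rmul (incl k Y q)).lTensor Y =
        counit ΔY q • evalRight (V := Y) (counit ΔY) :=
      LinearMap.ext fun t => evalRight_lTensor _ _ _ (hε.map_mul_right q) t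
    have h3 := hx.right q
    rw [rmul_tens_right, rmul_tens_right, rmul_tens_right, rmul_tens_left] at h3
    have h1 := congrArg ((evalRight (counit ΔY)).lTensor A) h3
    rw [evalRight_coverBar_aux, hε.evalRight_comulR2 hY, TensorProduct.tmul_smul, map_smul,
      map_smul, ← LinearMap.lTensor_comp_apply, h2,
      LinearMap.lTensor_smul, LinearMap.smul_apply] at h1
    rw [rmul_tens_right]
    exact smul_right_injective _ hq h1
  · exact (tmul_eq_zero_of_right h0 _).trans (tmul_eq_zero_of_right h0 _).symm

theorem coassocBar (h : IsComoduleCoalgebra ΔA ΔY ρ) (hA : IsRegularMultiplierHopf ΔA)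
    (hY : IsRegularMultiplierHopf ΔY) (a b : A) (y y' : Y) (x : A ⊗[k] (Y ⊗[k] Y))
    (hx : IsCoverBar ΔY ρ a y y' x) :
    rmul (tens 1 (tens 1 (incl k Y y'))) (iterTbar ΔA ρ b a y) = counitTbar ΔA ΔY ρ b x := by
  have hY2 := hY.isMultiplierHopf.mul'_surjective
  rw [h.counitTbar_eq hA hY, evalRight_coverBar hY hx,
    h.isComodule.coactTbar_coactTbar hA hY.nondegenerate hY2, rmul_tens_right, rmul_tens_right,
    lTensor_lTensor_assoc, lTensor_rTensor_comm]

/-- `y ⊗ b ⊗ v ↦ s(b) ⊗ y ⊗ v`. -/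
def moveLeft (s : A →ₗ[k] A) : Y ⊗[k] (A ⊗[k] Y) →ₗ[k] A ⊗[k] (Y ⊗[k] Y) :=
  (assoc k A Y Y).toLinearMap ∘ₗ
    ((TensorProduct.comm k Y A).toLinearMap ∘ₗ s.lTensor Y).rTensor Y ∘ₗ
    (assoc k Y A Y).symm.toLinearMap

theorem moveLeft_tmul (s : A →ₗ[k] A) (y : Y) (b : A) (v : Y) :
    moveLeft s (y ⊗ₜ (b ⊗ₜ v)) = s b ⊗ₜ (y ⊗ₜ v) := rfl

theorem moveLeft_lTensor (s : A →ₗ[k] A) (f : Y →ₗ[k] Y) (x : Y ⊗[k] (A ⊗[k] Y)) :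
    moveLeft s ((f.lTensor A).lTensor Y x) = (f.lTensor Y).lTensor A (moveLeft s x) := by
  refine LinearMap.congr_fun (f := moveLeft s ∘ₗ (f.lTensor A).lTensor Y)
    (g := (f.lTensor Y).lTensor A ∘ₗ moveLeft s) ?_ x
  ext y b v
  simp [moveLeft_tmul]

theorem moveLeft_rTensor (s : A →ₗ[k] A) (f : Y →ₗ[k] Y) (x : Y ⊗[k] (A ⊗[k] Y)) :
    moveLeft s (f.rTensor (A ⊗[k] Y) x) = (f.rTensor Y).lTensor A (moveLeft s x) := by
  refine LinearMap.congr_fun (f := moveLeft s ∘ₗ f.rTensor (A ⊗[k] Y))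
    (g := (f.rTensor Y).lTensor A ∘ₗ moveLeft s) ?_ x
  ext y b v
  simp [moveLeft_tmul]

theorem coveredBar (h : IsComoduleCoalgebra ΔA ΔY ρ) (hA : IsRegularMultiplierHopf ΔA)
    (hY : IsRegularMultiplierHopf ΔY) (a : A) (y y' : Y) :
    ∃ x, IsCoverBar ΔY ρ a y y' x := by
  have hY2 := hY.isMultiplierHopf.mul'_surjective
  obtain ⟨s, hs, hs'⟩ := h.isComodule.exists_antipode hA hY.nondegenerate hY2
  have he := h.isComodule.coactTEquiv_apply hA hY.nondegenerate hY2
  generalize h.isComodule.coactTEquiv hA hY.nondegenerate hY2 = e at he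
  -- Coverings add up in `a`, so `a` may be taken of the form `s(a, c) = aS(c)`.
  obtain ⟨z, rfl⟩ := hs a
  induction z using TensorProduct.induction_on with
  | zero => exact ⟨0, fun q => by simp, fun q => by simp⟩
  | add u v hu hv =>
    obtain ⟨x, hx⟩ := hu
    obtain ⟨x', hx'⟩ := hv
    exact ⟨x + x', fun q => by simp only [map_add, TensorProduct.add_tmul, hx.right, hx'.right],
      fun q => by simp only [map_add, TensorProduct.add_tmul, hx.left, hx'.left]⟩
  | tmul a c =>
    -- By the antipode identity, `T̄(s(a, c) ⊗ u)` is the flip of `(ι ⊗ s(a, ·))T⁻¹(c ⊗ u)`.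
    have h1 : ∀ r : Y ⊗[k] Y, moveLeft (s a) (assoc k Y A Y (e.symm.toLinearMap.rTensor Y
        ((assoc k A Y Y).symm (c ⊗ₜ r)))) = assoc k A Y Y ((coactTbar ρ).rTensor Y
          ((assoc k A Y Y).symm (s a c ⊗ₜ r))) := by
      intro r
      induction r using TensorProduct.induction_on with
      | zero => simp
      | add x y hx hy => simp only [map_add, TensorProduct.tmul_add, hx, hy]
      | tmul u v =>
        have h2 := hs' a (e.symm (c ⊗ₜ u))
        rw [← he, LinearEquiv.apply_symm_apply, LinearMap.rTensor_tmul] at h2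
        rw [TensorProduct.assoc_symm_tmul, TensorProduct.assoc_symm_tmul, LinearMap.rTensor_tmul,
          LinearMap.rTensor_tmul, h2]
        simp only [moveLeft, LinearMap.comp_apply, LinearEquiv.coe_coe,
          LinearEquiv.symm_apply_apply, LinearMap.rTensor_tmul]
    -- By (4), multiplying `T⁻¹(c ⊗ Δ_Y(y)(1 ⊗ q))` by `y'` on the first leg gives `(ι ⊗ T)` of
    -- `Δ_Y(·)(y' ⊗ 1)` at `T⁻¹(c ⊗ y)`, times `q` on the last leg. The part without `q` is an
    -- honest element of `Y ⊗ A ⊗ Y`, and `moveLeft` carries it to the required one.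
    refine ⟨moveLeft (s a) (coactTComul ΔY ρ y' (e.symm (c ⊗ₜ y))), fun q => ?_, fun q => ?_⟩
    · have h2 := congrArg (moveLeft (s a)) ((h.coactT_symm_cover_right hY he c y q).1 y')
      rw [rmul_tens_left, moveLeft_rTensor, h1, rmul_tens_right, rmul_tens_right,
        moveLeft_lTensor] at h2
      exact h2.symm
    · have h2 := congrArg (moveLeft (s a)) (h.coactT_symm_cover_left he c y q y')
      rw [rmul_tens_left, moveLeft_rTensor, h1, lmul_tens_right, lmul_tens_right,
        moveLeft_lTensor] at h2
      exact h2.symm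

end IsComoduleCoalgebra

end ComoduleCoalgebra
end
end MultHopf

theorem mainTheorem6 {k A Y : Type*} [Field k]
    [NonUnitalRing A] [Module k A] [IsScalarTower k A A] [SMulCommClass k A A]
    [NonUnitalRing Y] [Module k Y] [IsScalarTower k Y Y] [SMulCommClass k Y Y]
    (ΔA : A →ₗ[k] MultHopf.Multiplier k (A ⊗[k] A))
    (hA : MultHopf.IsRegularMultiplierHopf ΔA)
    (ΔY : Y →ₗ[k] MultHopf.Multiplier k (Y ⊗[k] Y))
    (hY : MultHopf.IsRegularMultiplierHopf ΔY)
    (ρ : Y →ₗ[k] MultHopf.Multiplier k (A ⊗[k] Y))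
    (hρ : MultHopf.IsComoduleCoalgebra ΔA ΔY ρ) :
    MultHopf.IsSymmetricPartialComoduleCoalgebra ΔA ΔY ρ where
  isPartial :=
    { mem_right := hρ.isComodule.mem_right
      counit_coact := hρ.isComodule.counit_coact hA hY.nondegenerate
        hY.isMultiplierHopf.mul'_surjective
      covered := hρ.covered
      compatible := hρ.compatible
      coassoc := hρ.coassoc hA hY }
  mem_left := hρ.isComodule.mem_left
  coveredBar := hρ.coveredBar hA hY
  coassocBar := hρ.coassocBar hA hY
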